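/- **Setting.** Fix $d\ge 0$, a crystallographic space group $\mathcal S$ acting on $\mathbb E^d$ (a properly discontinuous, cocompact group of isometries), a lattice $\mathcal L\subset\mathbb E^d$ (an $\mathcal S$-invariant set consisting of one point from each cell of each dimension of an $\mathcal S$-CW structure on $\mathbb E^d$), a group $G$, and homomorphisms $\rho_{\rm spa}:G\to\mathcal S$ and $\phi_{\rm int}:G\to\{\pm1\}$. *On-site data* $\ell=(\mathscr H,k,\rho_{\rm int})$ consist of a finite-dimensional Hilbert space $\mathscr H$, a number $k>0$, and a representation $\rho_{\rm int}$ of the action groupoid $G\ltimes_{\rho_{\rm spa}}\mathcal L$ on $\mathscr H$, where $\rho_{\rm int}(g,x)$ is antiunitary if $\phi_{\rm int}(g)=-1$ and unitary otherwise; so $\rho_{\rm int}(e,x)=1$ and $\rho_{\rm int}(g_1,\rho_{\rm spa}(g_2)x)\,\rho_{\rm int}(g_2,x)=\rho_{\rm int}(g_1g_2,x)$. A *local $G$-symmetric Hamiltonian* is a formal sum $H=\sum_X h_X$ over finite $X\subset\mathcal L$ of self-adjoint operators $h_X$ on $\bigotimes_{x\in X}\mathscr H$, uniformly bounded in norm,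 with $h_X=0$ unless $\operatorname{diam}X<k$, and with $\rho(g)h_X\rho(g)^{-1}=h_{gX}$, where $\rho(g)$ maps the factor at $x$ to the factor at $\rho_{\rm spa}(g)x$ by $\rho_{\rm int}(g,x)$. These form a real vector space $V_\ell$; give each $V_\ell$ any topology that makes it a topological vector space. Fix finite volumes $\Lambda_1\subset\Lambda_2\subset\cdots$ exhausting $\mathcal L$, with boundary conditions: $H_n$ is the sum of all $h_X$ with $X\subset\Lambda_n$ and of finitely many further terms moved into $\Lambda_n$ by prescribed injections $X\to\Lambda_n$ (none for open boundary conditions). For each $k$, boundedly many of the terms of diameter $<k$ act on any one site, uniformly in $n$ and the site; and for each site and each $k$, no moved terms of diameter $<k$ act on it once $n$ is large. $H$ is *gapped* if for some $\Delta>0$ and all large $n$, $H_n$ has a nondegenerate ground state with gap at least $\Delta$; we then say that $H$ has gap at least $\Delta$. Two gapped Hamiltonians *have the same ground state* if $H_n$ and $H'_n$ do for all large $n$. Let $Y_\ell\subset V_\ell$ be the space of gapped local $G$-symmetric Hamiltonians, let $Z_\ell$ be the space of ground states, i.e. the quotient space of $Y_\ell$ in which Hamiltonians with the same ground state are identified,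 and let $p_\ell:Y_\ell\to Z_\ell$ be the map to the ground state. An *inclusion* $(\mathscr H_0,k_0,\rho_{\rm int,0})\to(\mathscr H,k,\rho_{\rm int})$ is an isometry $J:\mathscr H_0\to\mathscr H$ with $\rho_{\rm int}(g,x)J=J\rho_{\rm int,0}(g,x)$, where $k_0\le k$. Two Hamiltonians (possibly with different on-site data) are in the same *topological phase* if there are inclusions into common on-site data $\ell$ and a path in $Y_\ell$ between modifications of them. Here a modification of $\sum h_X$ extends each $h_X$ by zero off $\bigotimes_{x\in X}J\mathscr H_0$, adds a penalty $C_x(1-JJ^*)$ with $C_x>0$ at each site $x$, is gapped, and has as its ground state the image of the original one. Two ground states are in the same topological phase if there are inclusions into common on-site data $\ell$ such that their images lie in $Z_\ell$ and are joined by a path in $Z_\ell$. **Theorem.** For all on-site data $\ell$: 1. If $H_0,H_1\in Y_\ell$ have the same ground state and $0\le t\le1$, then $(1-t)H_0+tH_1$ lies in $Y_\ell$ and has that ground state. If moreover $H_0$ and $H_1$ have gaps at least $\Delta_0>0$ and $\Delta_1>0$, then it has gap at least $(1-t)\Delta_0+t\Delta_1$. 2. Each fiber of $p_\ell$ is weakly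 contractible, i.e. nonempty with $\pi_n$ trivial for all $n\ge0$ and all base points. 3. $p_\ell$ is surjective. 4. If $p_\ell$ is a Serre fibration, then $p_\ell$ is a weak homotopy equivalence: it induces a bijection on $\pi_0$ and isomorphisms on $\pi_n$, $n\ge1$, for all base points. If $p_\ell$ is a Serre fibration for all $\ell$, then two gapped local $G$-symmetric Hamiltonians are in the same topological phase if and only if their ground states are; and $H\mapsto$ (ground state of $H$) induces a bijection between the topological phases of Hamiltonians and those of ground states (the classes of the equivalence relations generated by "in the same topological phase"). -/

import Mathlib

open scoped Topology Matrix
open scoped Classical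
open Filter

noncomputable section

namespace GappedPhases

/-! ### Serre fibrations, weak homotopy equivalences, weak contractibility -/

section Homotopy

variable {Y Z : Type*} [TopologicalSpace Y] [TopologicalSpace Z]

/-- A Serre fibration: a continuous map with the homotopy lifting property for all cubes. -/
def IsSerreFibration (p : Y → Z) : Prop :=
  Continuous p ∧
    ∀ (n : ℕ) (f : C(Fin n → unitInterval, Y)) (H : C(unitInterval × (Fin n → unitInterval), Z)),
      (∀ s, H (0, s) = p (f s)) →
        ∃ K : C(unitInterval × (Fin n → unitInterval), Y), (∀ s, K (0, s) = f s) ∧ ∀ a, p (K a) = H a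

/-- The map induced by a continuous map on generalized loops. -/
def genLoopMap (p : C(Y, Z)) (n : ℕ) (y : Y) (f : GenLoop (Fin n) Y y) :
    GenLoop (Fin n) Z (p y) :=
  ⟨p.comp f.1, fun s hs => congrArg p (f.2 s hs)⟩

/-- The map `π_n(Y, y) → π_n(Z, p y)` induced by a continuous map `p`. -/
def homotopyGroupMap (p : C(Y, Z)) (n : ℕ) (y : Y) :
    HomotopyGroup.Pi n Y y → HomotopyGroup.Pi n Z (p y) :=
  Quotient.map (genLoopMap p n y) fun _ _ h => h.elim fun H => ⟨H.compContinuousMap p⟩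

/-- The map `π_0(Y) → π_0(Z)` on path components induced by a continuous map `p`. -/
def pathComponentMap (p : C(Y, Z)) : ZerothHomotopy Y → ZerothHomotopy Z :=
  Quotient.map p fun _ _ h => h.map p.continuous

/-- A weak homotopy equivalence: a continuous map inducing a bijection on path components and
bijections (hence group isomorphisms) on all higher homotopy groups at all base points. -/
def IsWeakHomotopyEquiv (p : Y → Z) : Prop :=
  ∃ hp : Continuous p,
    Function.Bijective (pathComponentMap ⟨p, hp⟩) ∧
      ∀ (n : ℕ), 1 ≤ n → ∀ y : Y, Function.Bijective (homotopyGroupMap ⟨p, hp⟩ n y)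

/-- A space is weakly contractible if it is nonempty and `π_n(X, x)` is trivial for every `n ≥ 0`
and every base point. -/
def WeaklyContractible (X : Type*) [TopologicalSpace X] : Prop :=
  Nonempty X ∧ ∀ (n : ℕ) (x : X), Subsingleton (HomotopyGroup.Pi n X x)

end Homotopy

/-! ### Space groups and lattices -/

/-- The Euclidean space `𝔼^d`. -/
abbrev Euc (d : ℕ) : Type := EuclideanSpace ℝ (Fin d)

/-- A crystallographic space group: a properly discontinuous, cocompact group of isometries. -/
def IsSpaceGroup {d : ℕ} (S : Subgroup (Euc d ≃ᵢ Euc d)) : Prop :=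
  (∀ K : Set (Euc d), IsCompact K →
    {g : Euc d ≃ᵢ Euc d | g ∈ S ∧ ((g '' K) ∩ K).Nonempty}.Finite) ∧
  ∃ K : Set (Euc d), IsCompact K ∧ ∀ x, ∃ g ∈ S, g x ∈ K

/-- An `S`-CW structure: `S` permutes the open cells of each dimension, and an element that maps an
open cell to itself fixes it pointwise. -/
def IsEquivariantCW {d : ℕ} (S : Subgroup (Euc d ≃ᵢ Euc d))
    (cw : Topology.CWComplex (Set.univ : Set (Euc d))) : Prop :=
  ∀ g ∈ S, ∀ (n : ℕ) (e : cw.cell n),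
    (∃ e' : cw.cell n,
      g '' (cw.map n e '' Metric.ball 0 1) = cw.map n e' '' Metric.ball 0 1) ∧
    (g '' (cw.map n e '' Metric.ball 0 1) = cw.map n e '' Metric.ball 0 1 →
      ∀ x ∈ cw.map n e '' Metric.ball 0 1, g x = x)

/-- A lattice for the space group `S`: an `S`-invariant set consisting of exactly one point from
each open cell of each dimension of some `S`-CW structure on `𝔼^d`. -/
def IsLattice {d : ℕ} (S : Subgroup (Euc d ≃ᵢ Euc d)) (L : Set (Euc d)) : Prop :=
  (∀ g ∈ S, ∀ x ∈ L, g x ∈ L) ∧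
  ∃ cw : Topology.CWComplex (Set.univ : Set (Euc d)), IsEquivariantCW S cw ∧
    ∀ (n : ℕ) (e : cw.cell n), ∃! x, x ∈ L ∧ x ∈ cw.map n e '' Metric.ball 0 1

/-- The fixed data: a lattice in `𝔼^d` with its space group, the spatial action of the symmetry
group `G`, and the homomorphism telling which elements act antiunitarily. -/
structure Background (d : ℕ) (G : Type*) [Group G] where
  spaceGroup : Subgroup (Euc d ≃ᵢ Euc d)
  isSpaceGroup : IsSpaceGroup spaceGroup
  lattice : Set (Euc d)
  isLattice : IsLattice spaceGroup lattice
  /-- `ρ_spa` -/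
  spatial : G →* spaceGroup
  /-- `φ_int` -/
  sign : G →* ℤˣ

/-- The sites of the lattice. -/
abbrev Background.Site {d : ℕ} {G : Type*} [Group G] (B : Background d G) : Type :=
  {x : Euc d // x ∈ B.lattice}

/-- The action of `g` on the sites. -/
def Background.act {d : ℕ} {G : Type*} [Group G] (B : Background d G) (g : G) :
    B.Site ↪ B.Site where
  toFun x := ⟨(B.spatial g : Euc d ≃ᵢ Euc d) x.1, B.isLattice.1 _ (B.spatial g).2 _ x.2⟩
  inj' _ _ h := Subtype.ext ((B.spatial g : Euc d ≃ᵢ Euc d).injective (congrArg Subtype.val h))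

/-- The linear size of a finite set of sites. -/
def Background.size {d : ℕ} {G : Type*} [Group G] (B : Background d G) (X : Finset B.Site) : ℝ :=
  Metric.diam (Subtype.val '' (X : Set B.Site))

/-- An exhaustion of the lattice by finite volumes, with boundary conditions.  In the `n`-th finite
volume the local terms indexed by `terms n` are kept.  Those supported inside the volume are all
kept, in place; finitely many further ones may be kept, moved into the volume by `place` (for
instance to close the volume up to a torus or a sphere).  Away from the boundary only the original
terms act, and boundedly many terms of a given size act on any site.
Open boundary conditions: only the terms supported inside the volume are kept. -/
structure ThermodynamicLimit {d : ℕ} {G : Type*} [Group G] (B : Background d G) where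
  volume : ℕ → Finset B.Site
  volume_mono : Monotone volume
  volume_exhausts : ∀ x, ∃ n, x ∈ volume n
  terms : ℕ → Finset (Finset B.Site)
  place : ∀ (n : ℕ) (X : Finset B.Site), X ∈ terms n → (X ↪ volume n)
  bulk : ∀ (n : ℕ) (X : Finset B.Site), X ⊆ volume n →
    ∃ hX : X ∈ terms n, ∀ x : X, (place n X hX x : B.Site) = x
  eventually_bulk : ∀ (k : ℝ) (y : B.Site), ∀ᶠ n in atTop, ∀ (X : Finset B.Site)
    (hX : X ∈ terms n), B.size X < k → (∃ x, (place n X hX x : B.Site) = y) → X ⊆ volume n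
  multiplicity : ∀ k : ℝ, ∃ M : ℕ, ∀ (n : ℕ) (y : volume n),
    {X : {X // X ∈ terms n} | B.size X.1 < k ∧ ∃ x, place n X.1 X.2 x = y}.ncard ≤ M

/-! ### Operators on finite tensor products -/

/-- Operators on `⨂_{x ∈ α} ℂ^q`, in the product basis indexed by `α → Fin q`. -/
abbrev Op (α : Type*) (q : ℕ) := Matrix (α → Fin q) (α → Fin q) ℂ

/-- The operator on `⨂_{b ∈ β} ℂ^q` acting as `A` on the tensor factors in the image of the
injection `f`, and as the identity on the others. -/
def embedOp {α β : Type*} {q : ℕ} (f : α ↪ β) (A : Op α q) : Op β q :=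
  Matrix.of fun σ τ =>
    if ∀ b, b ∉ Set.range f → σ b = τ b then A (fun a => σ (f a)) (fun a => τ (f a)) else 0

/-- The tensor product `⨂_{x ∈ α} A_x : ⨂_{x ∈ α} ℂ^n → ⨂_{x ∈ α} ℂ^m`. -/
def tensorOp {α : Type*} [Fintype α] {m n : ℕ} (A : α → Matrix (Fin m) (Fin n) ℂ) :
    Matrix (α → Fin m) (α → Fin n) ℂ :=
  Matrix.of fun σ τ => ∏ x, A x (σ x) (τ x)

/-- `K^{-1} A K`, where `K` is the identity for `s = 1` and the (antiunitary) complex conjugation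
for `s = -1`. -/
def twist {m n : Type*} (s : ℤˣ) (A : Matrix m n ℂ) : Matrix m n ℂ :=
  if s = 1 then A else A.map (starRingEnd ℂ)

/-- The expectation `⟨v, A v⟩` (its real part; for Hermitian `A` it is real). -/
def expect {c : Type*} [Fintype c] (A : Matrix c c ℂ) (v : c → ℂ) : ℝ :=
  (star v ⬝ᵥ (A *ᵥ v)).re

/-- The squared norm of a vector. -/
def normSq {c : Type*} [Fintype c] (v : c → ℂ) : ℝ := (star v ⬝ᵥ v).re

/-- `ψ` is a ground state vector of `A`: an eigenvector with the lowest eigenvalue. -/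
def IsGroundVector {c : Type*} [Fintype c] (A : Matrix c c ℂ) (ψ : c → ℂ) : Prop :=
  ψ ≠ 0 ∧ ∃ E : ℝ, A *ᵥ ψ = (E : ℂ) • ψ ∧ ∀ v, E * normSq v ≤ expect A v

/-- `A` has a ground state vector `ψ`, of energy `E`, such that every vector orthogonal to `ψ` has
energy at least `E + Δ`.  For `Δ > 0` the ground state is thus nondegenerate. -/
def HasGap {c : Type*} [Fintype c] (A : Matrix c c ℂ) (Δ : ℝ) : Prop :=
  ∃ (ψ : c → ℂ) (E : ℝ), ψ ≠ 0 ∧ A *ᵥ ψ = (E : ℂ) • ψ ∧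
    ∀ v, star ψ ⬝ᵥ v = 0 → (E + Δ) * normSq v ≤ expect A v

/-! ### Hamiltonians -/

variable {d : ℕ} {G : Type*} [Group G] {B : Background d G}

/-- The on-site data: a Hilbert space `ℂ^dim`, an upper bound `range` on the linear size of the
local terms, and a representation `ρ_int` of the action groupoid `G ⋉ L` on `ℂ^dim` by unitary or
antiunitary operators: `ρ_int(g, x)` is `v ↦ rep g x v` if `φ_int(g) = 1`, and `v ↦ rep g x v̄` if
`φ_int(g) = -1`. -/
structure OnSite (B : Background d G) where
  dim : ℕ
  range : ℝ
  range_pos : 0 < range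
  rep : G → B.Site → Matrix (Fin dim) (Fin dim) ℂ
  rep_unitary : ∀ g x, rep g x ∈ Matrix.unitaryGroup (Fin dim) ℂ
  rep_one : ∀ x, rep 1 x = 1
  rep_mul : ∀ g₁ g₂ x, rep g₁ (B.act g₂ x) * twist (B.sign g₁) (rep g₂ x) = rep (g₁ * g₂) x

/-- A formal sum `∑_X h_X` of operators `h_X` on `⨂_{x ∈ X} ℂ^q`, `X` a finite set of sites. -/
abbrev Interaction (B : Background d G) (q : ℕ) := (X : Finset B.Site) → Op X q

/-- The bijection `X → gX`. -/
def actOn (B : Background d G) (g : G) (X : Finset B.Site) :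
    X ↪ {y // y ∈ X.map (B.act g)} where
  toFun x := ⟨B.act g x.1, Finset.mem_map_of_mem _ x.2⟩
  inj' _ _ h := Subtype.ext ((B.act g).injective (congrArg Subtype.val h))

/-- `ρ(g) A ρ(g)⁻¹` for an operator `A` on `X`, as an operator on `gX`; here `ρ(g)` maps the factor
at `x` to the factor at `gx` by `ρ_int(g, x)`. -/
def conjugate (ℓ : OnSite B) (g : G) {X : Finset B.Site} (A : Op X ℓ.dim) :
    Op {y // y ∈ X.map (B.act g)} ℓ.dim :=
  embedOp (actOn B g X)
    (tensorOp (fun x : X => ℓ.rep g x) * twist (B.sign g) A *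
      (tensorOp (fun x : X => ℓ.rep g x))ᴴ)

/-- `h` is a local, `G`-symmetric Hamiltonian: its terms are Hermitian, vanish unless supported on
sets of linear size `< range`, are uniformly bounded in operator norm, and are permuted by the
symmetry. -/
def IsLocalSymmetric (ℓ : OnSite B) (h : Interaction B ℓ.dim) : Prop :=
  (∀ X, (h X).IsHermitian) ∧
  (∀ X, ¬ B.size X < ℓ.range → h X = 0) ∧
  (∃ C : ℝ, ∀ X v, |expect (h X) v| ≤ C * normSq v) ∧
  ∀ g X, h (X.map (B.act g)) = conjugate ℓ g (h X)

theorem embedOp_add {α β : Type*} {q : ℕ} (f : α ↪ β) (A A' : Op α q) :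
    embedOp f (A + A') = embedOp f A + embedOp f A' := by
  ext σ τ
  by_cases h : ∀ b, b ∉ Set.range f → σ b = τ b
  · simp only [embedOp, Matrix.of_apply, Matrix.add_apply, if_pos h]
  · simp only [embedOp, Matrix.of_apply, Matrix.add_apply, if_neg h, add_zero]

theorem embedOp_smul {α β : Type*} {q : ℕ} (f : α ↪ β) (r : ℝ) (A : Op α q) :
    embedOp f (r • A) = r • embedOp f A := by
  ext σ τ
  by_cases h : ∀ b, b ∉ Set.range f → σ b = τ b
  · simp only [embedOp, Matrix.of_apply, Matrix.smul_apply, if_pos h]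
  · simp only [embedOp, Matrix.of_apply, Matrix.smul_apply, if_neg h, smul_zero]

theorem twist_add {m n : Type*} (s : ℤˣ) (A A' : Matrix m n ℂ) :
    twist s (A + A') = twist s A + twist s A' := by
  unfold twist
  split_ifs
  · rfl
  · ext i j; simp

theorem twist_smul {m n : Type*} (s : ℤˣ) (r : ℝ) (A : Matrix m n ℂ) :
    twist s (r • A) = r • twist s A := by
  unfold twist
  split_ifs
  · rfl
  · ext i j; simp

theorem conjugate_add (ℓ : OnSite B) (g : G) {X : Finset B.Site} (A A' : Op X ℓ.dim) :
    conjugate ℓ g (A + A') = conjugate ℓ g A + conjugate ℓ g A' := by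
  simp only [conjugate, twist_add, Matrix.mul_add, Matrix.add_mul, embedOp_add]

theorem conjugate_smul (ℓ : OnSite B) (g : G) {X : Finset B.Site} (r : ℝ) (A : Op X ℓ.dim) :
    conjugate ℓ g (r • A) = r • conjugate ℓ g A := by
  simp only [conjugate, twist_smul, Matrix.mul_smul, Matrix.smul_mul, embedOp_smul]

theorem expect_add {c : Type*} [Fintype c] (A A' : Matrix c c ℂ) (v : c → ℂ) :
    expect (A + A') v = expect A v + expect A' v := by
  simp [expect, Matrix.add_mulVec, dotProduct_add]

theorem expect_smul {c : Type*} [Fintype c] (r : ℝ) (A : Matrix c c ℂ) (v : c → ℂ) :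
    expect (r • A) v = r * expect A v := by
  simp [expect, Matrix.smul_mulVec, dotProduct_smul]

/-- The real vector space of all local `G`-symmetric Hamiltonians with given on-site data. -/
def hamSubmodule (ℓ : OnSite B) : Submodule ℝ (Interaction B ℓ.dim) where
  carrier := {h | IsLocalSymmetric ℓ h}
  zero_mem' := by
    have hc : ∀ g (X : Finset B.Site), conjugate ℓ g (0 : Op X ℓ.dim) = 0 := fun g X => by
      simpa using conjugate_smul ℓ g (0 : ℝ) (0 : Op X ℓ.dim)
    refine ⟨fun X => Matrix.isHermitian_zero, fun X _ => rfl, ⟨0, fun X v => ?_⟩,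
      fun g X => (hc g X).symm⟩
    simp [expect]
  add_mem' := by
    rintro h h' ⟨a1, a2, ⟨C, a3⟩, a4⟩ ⟨b1, b2, ⟨C', b3⟩, b4⟩
    refine ⟨fun X => (a1 X).add (b1 X), fun X hX => ?_, ⟨C + C', fun X v => ?_⟩, fun g X => ?_⟩
    · simp [a2 X hX, b2 X hX]
    · have := abs_add_le (expect (h X) v) (expect (h' X) v)
      rw [Pi.add_apply, expect_add]
      linarith [a3 X v, b3 X v]
    · simp only [Pi.add_apply, conjugate_add, a4, b4]
  smul_mem' := by
    rintro r h ⟨a1, a2, ⟨C, a3⟩, a4⟩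
    refine ⟨fun X => ?_, fun X hX => ?_, ⟨|r| * C, fun X v => ?_⟩, fun g X => ?_⟩
    · have := a1 X
      rw [Matrix.IsHermitian] at this ⊢
      rw [Pi.smul_apply, Matrix.conjTranspose_smul, this, star_trivial]
    · simp [a2 X hX]
    · rw [Pi.smul_apply, expect_smul, abs_mul, mul_assoc]
      exact mul_le_mul_of_nonneg_left (a3 X v) (abs_nonneg r)
    · simp only [Pi.smul_apply, conjugate_smul, a4]

/-- The real vector space of all local `G`-symmetric Hamiltonians with given on-site data,
as a type without a chosen topology. -/
def Ham (ℓ : OnSite B) : Type := hamSubmodule ℓ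

instance (ℓ : OnSite B) : AddCommGroup (Ham ℓ) := inferInstanceAs (AddCommGroup (hamSubmodule ℓ))
instance (ℓ : OnSite B) : Module ℝ (Ham ℓ) := inferInstanceAs (Module ℝ (hamSubmodule ℓ))

/-- The local terms of a Hamiltonian. -/
def Ham.term {ℓ : OnSite B} (h : Ham ℓ) : Interaction B ℓ.dim := h.1

/-- The Hamiltonian of the `n`-th finite volume. -/
def finiteHam (T : ThermodynamicLimit B) {ℓ : OnSite B} (h : Ham ℓ) (n : ℕ) :
    Op (T.volume n) ℓ.dim :=
  ∑ X : {X // X ∈ T.terms n}, embedOp (T.place n X.1 X.2) (h.term X.1)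

/-- In the thermodynamic limit, `h` has a nondegenerate ground state with a gap of at least `Δ`
above it. -/
def GapAtLeast (T : ThermodynamicLimit B) {ℓ : OnSite B} (h : Ham ℓ) (Δ : ℝ) : Prop :=
  ∀ᶠ n in atTop, HasGap (finiteHam T h n) Δ

/-- `h` is gapped: it has a unique gapped ground state in the thermodynamic limit. -/
def IsGapped (T : ThermodynamicLimit B) {ℓ : OnSite B} (h : Ham ℓ) : Prop :=
  ∃ Δ : ℝ, 0 < Δ ∧ GapAtLeast T h Δ

/-- Two Hamiltonians have the same ground state (in all sufficiently large volumes). -/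
def SameGroundState (T : ThermodynamicLimit B) {ℓ : OnSite B} (h h' : Ham ℓ) : Prop :=
  ∀ᶠ n in atTop, ∀ ψ, IsGroundVector (finiteHam T h n) ψ ↔ IsGroundVector (finiteHam T h' n) ψ

/-- The space of gapped local `G`-symmetric Hamiltonians. -/
def GappedHam (T : ThermodynamicLimit B) (ℓ : OnSite B) : Type := {h : Ham ℓ // IsGapped T h}

/-- Gapped Hamiltonians are identified when they have the same ground state. -/
def groundStateSetoid (T : ThermodynamicLimit B) (ℓ : OnSite B) : Setoid (GappedHam T ℓ) where
  r h h' := SameGroundState T h.1 h'.1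
  iseqv :=
    { refl := fun _ => Eventually.of_forall fun _ _ => Iff.rfl
      symm := fun H => H.mono fun _ hn ψ => (hn ψ).symm
      trans := fun H H' => (H.and H').mono fun _ hn ψ => (hn.1 ψ).trans (hn.2 ψ) }

/-- The space of ground states of gapped local `G`-symmetric Hamiltonians, as a quotient space of
the space of such Hamiltonians. -/
def GroundStates (T : ThermodynamicLimit B) (ℓ : OnSite B) : Type :=
  Quotient (groundStateSetoid T ℓ)

instance (T : ThermodynamicLimit B) (ℓ : OnSite B) [TopologicalSpace (Ham ℓ)] :
    TopologicalSpace (GappedHam T ℓ) :=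
  inferInstanceAs (TopologicalSpace {h : Ham ℓ // IsGapped T h})

instance (T : ThermodynamicLimit B) (ℓ : OnSite B) [TopologicalSpace (Ham ℓ)] :
    TopologicalSpace (GroundStates T ℓ) :=
  inferInstanceAs (TopologicalSpace (Quotient (groundStateSetoid T ℓ)))

/-- The map from gapped Hamiltonians to their ground states. -/
def groundState (T : ThermodynamicLimit B) (ℓ : OnSite B) : GappedHam T ℓ → GroundStates T ℓ :=
  Quotient.mk (groundStateSetoid T ℓ)

/-! ### Topological phases -/

/-- An inclusion of on-site data: an isometry `V : ℋ₀ → ℋ` that intertwines the representations,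
with an upper bound on the range that is at least as large. -/
structure Inclusion (ℓ₀ ℓ : OnSite B) where
  V : Matrix (Fin ℓ.dim) (Fin ℓ₀.dim) ℂ
  isometry : Vᴴ * V = 1
  intertwines : ∀ g x, ℓ.rep g x * twist (B.sign g) V = V * ℓ₀.rep g x
  range_le : ℓ₀.range ≤ ℓ.range

/-- `⨂_{x ∈ α} V`. -/
def Inclusion.tensor {ℓ₀ ℓ : OnSite B} (j : Inclusion ℓ₀ ℓ) (α : Type*) [Fintype α] :
    Matrix (α → Fin ℓ.dim) (α → Fin ℓ₀.dim) ℂ :=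
  tensorOp fun _ : α => j.V

/-- The ground state of `h'` is the image of the ground state of `h` under `⨂_x V`. -/
def CarriesGroundState (T : ThermodynamicLimit B) {ℓ₀ ℓ : OnSite B} (j : Inclusion ℓ₀ ℓ)
    (h : Ham ℓ₀) (h' : Ham ℓ) : Prop :=
  ∀ᶠ n in atTop, ∀ ψ, IsGroundVector (finiteHam T h n) ψ →
    IsGroundVector (finiteHam T h' n) (j.tensor (T.volume n) *ᵥ ψ)

/-- The extension of an operator by zero on the orthogonal complement of `⨂_x ℋ₀`. -/
def Inclusion.extend {ℓ₀ ℓ : OnSite B} (j : Inclusion ℓ₀ ℓ) {X : Finset B.Site}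
    (A : Op X ℓ₀.dim) : Op X ℓ.dim :=
  j.tensor X * A * (j.tensor X)ᴴ

/-- The projection onto the orthogonal complement of `ℋ₀` in `ℋ` at one site, as an operator on
the set `X` (used for one-point sets `X`). -/
def Inclusion.complement {ℓ₀ ℓ : OnSite B} (j : Inclusion ℓ₀ ℓ) (X : Finset B.Site) :
    Op X ℓ.dim :=
  tensorOp fun _ : X => 1 - j.V * j.Vᴴ

/-- `h'` is `h` modified so as to give states orthogonal to `ℋ₀` a higher energy: each local term
of `h` is extended by zero to the larger Hilbert space, a penalty `C x > 0` is given to the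
complement of `ℋ₀` at each site `x`, and the ground state remains that of `h`. -/
def IsModification (T : ThermodynamicLimit B) {ℓ₀ ℓ : OnSite B} (j : Inclusion ℓ₀ ℓ)
    (h : GappedHam T ℓ₀) (h' : GappedHam T ℓ) : Prop :=
  (∃ C : B.Site → ℝ, (∀ x, 0 < C x) ∧
    (∀ x, h'.1.term {x} = j.extend (h.1.term {x}) + C x • j.complement {x}) ∧
    ∀ X, X.card ≠ 1 → h'.1.term X = j.extend (h.1.term X)) ∧
  CarriesGroundState T j h.1 h'.1

/-- The ground state `z'` is the image of the ground state `z` under `⨂_x V`. -/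
def IsImageState (T : ThermodynamicLimit B) {ℓ₀ ℓ : OnSite B} (j : Inclusion ℓ₀ ℓ)
    (z : GroundStates T ℓ₀) (z' : GroundStates T ℓ) : Prop :=
  ∃ (h : GappedHam T ℓ₀) (h' : GappedHam T ℓ),
    groundState T ℓ₀ h = z ∧ groundState T ℓ h' = z' ∧ CarriesGroundState T j h.1 h'.1

/-- A gapped system given by a Hamiltonian, with arbitrary on-site data. -/
abbrev HamSystem (T : ThermodynamicLimit B) := Σ ℓ : OnSite B, GappedHam T ℓ

/-- A gapped system given by a ground state, with arbitrary on-site data. -/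
abbrev StateSystem (T : ThermodynamicLimit B) := Σ ℓ : OnSite B, GroundStates T ℓ

/-- The ground state of a system given by a Hamiltonian. -/
def HamSystem.groundState {T : ThermodynamicLimit B} (a : HamSystem T) : StateSystem T :=
  ⟨a.1, GappedPhases.groundState T a.1 a.2⟩

/-- Two Hamiltonians are in the same topological phase: after inclusion into common on-site data
and modification, there is a path of gapped local `G`-symmetric Hamiltonians between them. -/
def SamePhaseHam (T : ThermodynamicLimit B) [∀ ℓ : OnSite B, TopologicalSpace (Ham ℓ)]
    (a b : HamSystem T) : Prop :=
  ∃ (ℓ : OnSite B) (j : Inclusion a.1 ℓ) (j' : Inclusion b.1 ℓ) (h h' : GappedHam T ℓ),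
    IsModification T j a.2 h ∧ IsModification T j' b.2 h' ∧ Joined h h'

/-- Two ground states are in the same topological phase: after inclusion into common on-site data,
there is a path of ground states between them. -/
def SamePhaseState (T : ThermodynamicLimit B) [∀ ℓ : OnSite B, TopologicalSpace (Ham ℓ)]
    (a b : StateSystem T) : Prop :=
  ∃ (ℓ : OnSite B) (j : Inclusion a.1 ℓ) (j' : Inclusion b.1 ℓ) (z z' : GroundStates T ℓ),
    IsImageState T j a.2 z ∧ IsImageState T j' b.2 z' ∧ Joined z z'

end GappedPhases

end

open GappedPhases

namespace GappedPhases

noncomputable section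

/-! ### Maps with convex fibers -/

section ConvexFibers

open unitInterval

variable {V Z : Type*} [AddCommGroup V] [Module ℝ V] {P : V → Prop}

/-! Everything rests on the variational principle. A common ground vector of `A₀` and `A₁` is an
eigenvector of every convex combination, and the lower bounds on expectations, both on all vectors
and on the orthogonal complement of that vector, combine linearly (`HasGap.interpolate`). Hence the
fibers of `groundState` are convex; surjectivity holds because the target is a quotient.

Nonempty convex fibers are contracted along straight segments. For a Serre fibration, a lifted path
or homotopy ends at the right point only up to the fiber, and a segment in the fiber closes the
difference. For higher homotopy groups the boundary of the cube must in addition return to the base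
point. This is arranged by shrinking the map to an inner cube and interpolating to the base point on
a collar (`HasConvexFibers.exists_collar`), so no long exact sequence is needed.

For phases, a path of ground states must become a path between modifications, so modifications must
exist for every inclusion (`exists_isModification`). If the terms are bounded by `c` and at most `M`
of them act on a site, the penalty `M * c + Δ` suffices: leaving the smaller Hilbert space at one
site disables at most `M` terms, which lowers the energy by at most `M * c`. Products of Kraus
operators split the energy of a vector by the set of excited sites. The sector without excitations
inherits the original gap, and every other sector lies at least `Δ` above the ground energy
(`expect_sectorHam_ge`, `hasGap_modify`). Since a gapped ground state is a single ray, its image is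
unique (`groundState_eq_of_carries`), so the modifications have the prescribed ground states. -/

/-- A map on a subset of a real vector space, all of whose fibers are convex. -/
def HasConvexFibers (p : {v // P v} → Z) : Prop :=
  ∀ y₀ y₁, p y₀ = p y₁ → ∀ t : ℝ, 0 ≤ t → t ≤ 1 →
    ∃ y : {v // P v}, y.1 = (1 - t) • y₀.1 + t • y₁.1 ∧ p y = p y₀

/-- Linear interpolation inside the fibers, over a parameter space. -/
theorem HasConvexFibers.exists_interpolation [TopologicalSpace V] [IsTopologicalAddGroup V]
    [ContinuousSMul ℝ V] {p : {v // P v} → Z} (hc : HasConvexFibers p)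
    {X : Type*} [TopologicalSpace X] {f g : X → {v // P v}} (hf : Continuous f)
    (hg : Continuous g) {t : X → ℝ} (ht : Continuous t) (h0 : ∀ x, 0 ≤ t x) (h1 : ∀ x, t x ≤ 1)
    (hfg : ∀ x, t x ≠ 0 → p (f x) = p (g x)) :
    ∃ k : C(X, {v // P v}), (∀ x, (k x).1 = (1 - t x) • (f x).1 + t x • (g x).1) ∧
      ∀ x, p (k x) = p (f x) := by
  have key : ∀ x, ∃ y : {v // P v}, y.1 = (1 - t x) • (f x).1 + t x • (g x).1 ∧
      p y = p (f x) := by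
    intro x
    -- Where the weight vanishes nothing is required of `g x`. The collar argument depends on this:
    -- there the two maps share a fiber only near the boundary.
    by_cases h : t x = 0
    · exact ⟨f x, by simp [h], rfl⟩
    · exact hc _ _ (hfg x h) _ (h0 x) (h1 x)
  choose k hk hp using key
  have hcont : Continuous k := by
    refine continuous_induced_rng.2 ?_
    have : Subtype.val ∘ k = fun x => (1 - t x) • (f x).1 + t x • (g x).1 := funext hk
    rw [this]
    fun_prop
  exact ⟨⟨k, hcont⟩, hk, hp⟩

/-- A homotopy that is constant on the boundary of the cube identifies generalized loops. -/
theorem genLoop_homotopic_of_map {Y : Type*} [TopologicalSpace Y] {n : ℕ} {y : Y}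
    {f g : GenLoop (Fin n) Y y} (L : C(I × (Fin n → I), Y)) (h0 : ∀ s, L (0, s) = f s)
    (h1 : ∀ s, L (1, s) = g s) (hb : ∀ t, ∀ s ∈ Cube.boundary (Fin n), L (t, s) = y) :
    GenLoop.Homotopic f g :=
  ⟨{ toFun := L
     continuous_toFun := L.continuous
     map_zero_left := h0
     map_one_left := h1
     prop' := fun t s hs => (hb t s hs).trans (f.2 s hs).symm }⟩

/-- The fibers of a map with convex fibers are weakly contractible if nonempty. -/
theorem HasConvexFibers.weaklyContractible [TopologicalSpace V] [IsTopologicalAddGroup V]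
    [ContinuousSMul ℝ V] {p : {v // P v} → Z} (hc : HasConvexFibers p)
    (hs : Function.Surjective p) (z : Z) : WeaklyContractible {y // p y = z} := by
  refine ⟨(hs z).elim fun y hy => ⟨⟨y, hy⟩⟩, fun n x => ⟨?_⟩⟩
  suffices h : ∀ f : GenLoop (Fin n) {y // p y = z} x, GenLoop.Homotopic f GenLoop.const by
    intro a b
    induction a using Quotient.inductionOn with | _ f
    induction b using Quotient.inductionOn with | _ g
    exact Quotient.sound ((h f).trans (h g).symm)
  intro f
  -- Contraction along segments to the base point. On the boundary `f` is already `x`, so the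
  -- homotopy is stationary there.
  obtain ⟨k, hk, hkp⟩ := hc.exists_interpolation (X := I × (Fin n → I))
    (f := fun a => (f a.2).1) (g := fun _ => x.1) (t := fun a => (a.1 : ℝ))
    (continuous_subtype_val.comp (f.1.continuous.comp continuous_snd)) continuous_const
    (by fun_prop) (fun a => a.1.2.1) (fun a => a.1.2.2) (fun a _ => (f a.2).2.trans x.2.symm)
  refine genLoop_homotopic_of_map
    ⟨fun a => ⟨k a, (hkp a).trans (f a.2).2⟩, k.continuous.subtype_mk _⟩ ?_ ?_ ?_
  · intro s
    refine Subtype.ext (Subtype.ext ?_)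
    simp [hk]
  · intro s
    refine Subtype.ext (Subtype.ext ?_)
    simp [hk]
  · intro t s hs
    refine Subtype.ext (Subtype.ext ?_)
    have : f s = x := f.2 s hs
    simp [hk, this, ← add_smul]

/-! #### A collar of the boundary of the cube -/

/-- A family of self-maps of the interval, fixing the end points, that for `u = 0` is the identity
and for `u = 1` collapses the two outer quarters. -/
def squeeze (u a : I) : I := Set.projIcc 0 1 zero_le_one ((1 + u) * a - u / 2 : ℝ)

theorem continuous_squeeze : Continuous fun a : I × I => squeeze a.1 a.2 := by
  unfold squeeze
  exact continuous_projIcc.comp (by fun_prop)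

theorem squeeze_zero_left (a : I) : squeeze 0 a = a := by
  simp [squeeze]

theorem squeeze_zero_right (u : I) : squeeze u 0 = 0 :=
  Set.projIcc_of_le_left _ (by have := u.2.1; simp; linarith)

theorem squeeze_one_right (u : I) : squeeze u 1 = 1 :=
  Set.projIcc_of_right_le _ (by have := u.2.1; simp; linarith)

/-- The retraction of the cube along the collar onto an inner cube, rescaled. -/
def squeezeCube {n : ℕ} (u : I) (s : Fin n → I) : Fin n → I := fun i => squeeze u (s i)

theorem continuous_squeezeCube {n : ℕ} :
    Continuous fun a : I × (Fin n → I) => squeezeCube a.1 a.2 :=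
  continuous_pi fun i =>
    continuous_squeeze.comp (continuous_fst.prodMk ((continuous_apply i).comp continuous_snd))

theorem squeezeCube_mem_boundary {n : ℕ} (u : I) {s : Fin n → I}
    (hs : s ∈ Cube.boundary (Fin n)) : squeezeCube u s ∈ Cube.boundary (Fin n) := by
  obtain ⟨i, h | h⟩ := hs
  · exact ⟨i, Or.inl (by rw [squeezeCube, h, squeeze_zero_right])⟩
  · exact ⟨i, Or.inr (by rw [squeezeCube, h, squeeze_one_right])⟩

/-- A function on the cube that vanishes outside a collar of the boundary, and is `1` on it. -/
def collarWeight {n : ℕ} (s : Fin n → I) : ℝ :=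
  -- In the sup metric, a coordinate `a` contributes `1 - 4a` on the first quarter, `0` on the
  -- middle half, where `squeeze 1 a = 2a - 1/2`, and `4a - 3` on the last quarter.
  dist (fun i => (4 * (s i : ℝ) - 1)) (fun i => 2 * (squeeze 1 (s i) : ℝ))

theorem continuous_collarWeight {n : ℕ} : Continuous (collarWeight (n := n)) := by
  unfold collarWeight
  refine Continuous.dist (by fun_prop) (continuous_pi fun i => ?_)
  exact continuous_const.mul (continuous_subtype_val.comp
    (continuous_squeeze.comp (continuous_const.prodMk (continuous_apply i))))

theorem collarWeight_nonneg {n : ℕ} (s : Fin n → I) : 0 ≤ collarWeight s := dist_nonneg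

theorem squeeze_one_cases (a : I) :
    (squeeze 1 a = 0 ∧ (a : ℝ) ≤ 1 / 4) ∨ (squeeze 1 a = 1 ∧ 3 / 4 ≤ (a : ℝ)) ∨
      (squeeze 1 a : ℝ) = 2 * a - 1 / 2 := by
  rcases le_total (a : ℝ) (1 / 4) with h | h
  · exact Or.inl ⟨Set.projIcc_of_le_left _ (by simp; linarith), h⟩
  rcases le_total (3 / 4) (a : ℝ) with h' | h'
  · exact Or.inr (Or.inl ⟨Set.projIcc_of_right_le _ (by simp; linarith), h'⟩)
  · refine Or.inr (Or.inr ?_)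
    rw [squeeze, Set.projIcc_of_mem _ ⟨by simp; linarith, by simp; linarith⟩]
    simp only [Set.Icc.coe_one]
    ring

theorem collarWeight_le_one {n : ℕ} (s : Fin n → I) : collarWeight s ≤ 1 := by
  refine (dist_pi_le_iff zero_le_one).2 fun i => ?_
  have h0 := (s i).2.1
  have h1 := (s i).2.2
  rw [Real.dist_eq, abs_le]
  rcases squeeze_one_cases (s i) with ⟨h, h'⟩ | ⟨h, h'⟩ | h <;> rw [h] <;>
    constructor <;> simp <;> linarith

theorem collarWeight_eq_one {n : ℕ} {s : Fin n → I} (hs : s ∈ Cube.boundary (Fin n)) :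
    collarWeight s = 1 := by
  refine le_antisymm (collarWeight_le_one s) ?_
  obtain ⟨i, h | h⟩ := hs
  · refine le_trans ?_ (dist_le_pi_dist _ _ i)
    simp [h, squeeze_zero_right]
  · refine le_trans ?_ (dist_le_pi_dist _ _ i)
    simp [h, squeeze_one_right, Real.dist_eq]
    norm_num

/-- A nonzero weight forces some coordinate into an outer quarter, which `squeeze 1` collapses to an
end point. This is what permits interpolation on the collar: the squeezed map takes its boundary
values there, and these lie in one fiber. -/
theorem squeezeCube_mem_boundary_of_collarWeight_ne_zero {n : ℕ} {s : Fin n → I}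
    (hs : collarWeight s ≠ 0) : squeezeCube 1 s ∈ Cube.boundary (Fin n) := by
  contrapose! hs
  refine dist_eq_zero.2 (funext fun i => ?_)
  rcases squeeze_one_cases (s i) with h | h | h
  · exact absurd ⟨i, Or.inl h.1⟩ hs
  · exact absurd ⟨i, Or.inr h.1⟩ hs
  · rw [h]; ring

/-- Precomposition of a generalized loop with the retraction along the collar. -/
def squeezeLoop {Y : Type*} [TopologicalSpace Y] {n : ℕ} {y : Y} (f : GenLoop (Fin n) Y y) :
    GenLoop (Fin n) Y y :=
  ⟨⟨fun s => f (squeezeCube 1 s),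
      f.1.continuous.comp (continuous_squeezeCube.comp (Continuous.prodMk_right (1 : I)))⟩,
    fun _ hs => f.2 _ (squeezeCube_mem_boundary 1 hs)⟩

/-- Let the squeezing parameter run from `0` to `1`; every stage preserves the boundary of the cube.
-/
theorem homotopic_squeezeLoop {Y : Type*} [TopologicalSpace Y] {n : ℕ} {y : Y}
    (f : GenLoop (Fin n) Y y) : GenLoop.Homotopic f (squeezeLoop f) := by
  refine genLoop_homotopic_of_map ⟨fun a => f (squeezeCube a.1 a.2),
    f.1.continuous.comp continuous_squeezeCube⟩ (fun s => ?_) (fun s => rfl)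
    fun t s hs => f.2 _ (squeezeCube_mem_boundary t hs)
  exact congrArg f (funext fun i => squeeze_zero_left (s i))

variable [TopologicalSpace V] [IsTopologicalAddGroup V] [ContinuousSMul ℝ V] {p : {v // P v} → Z}

/-- A family of maps of cubes whose boundaries lie in a convex fiber can be modified on the collar
so as to become a family of generalized loops. -/
theorem HasConvexFibers.exists_collar (hc : HasConvexFibers p) {X : Type*} [TopologicalSpace X]
    {n : ℕ} {L : X × (Fin n → I) → {v // P v}} (hL : Continuous L) (y : {v // P v})
    (hb : ∀ t, ∀ s ∈ Cube.boundary (Fin n), p (L (t, s)) = p y) :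
    ∃ L' : C(X × (Fin n → I), {v // P v}),
      (∀ t, ∀ s ∈ Cube.boundary (Fin n), L' (t, s) = y) ∧
      (∀ t s, (∀ s ∈ Cube.boundary (Fin n), L (t, s) = y) →
        L' (t, s) = L (t, squeezeCube 1 s)) ∧
      ∀ t s, p (L' (t, s)) = p (L (t, squeezeCube 1 s)) := by
  have hr : Continuous fun a : X × (Fin n → I) => (a.1, squeezeCube 1 a.2) :=
    continuous_fst.prodMk
      ((continuous_squeezeCube.comp (Continuous.prodMk_right (1 : I))).comp continuous_snd)
  -- Squeeze first, then move towards `y` with the collar weight: on the boundary the weight is `1`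
  -- and the value becomes exactly `y`.
  obtain ⟨k, hk, hkp⟩ := hc.exists_interpolation (hL.comp hr)
    (g := fun _ => y) continuous_const (continuous_collarWeight.comp continuous_snd)
    (fun a => collarWeight_nonneg a.2) (fun a => collarWeight_le_one a.2)
    (fun a ha => hb _ _ (squeezeCube_mem_boundary_of_collarWeight_ne_zero ha))
  refine ⟨k, fun t s hs => Subtype.ext ?_, fun t s h => Subtype.ext ?_, fun t s => hkp _⟩
  · simp [hk, collarWeight_eq_one hs]
  -- If `L (t, ·)` already equals `y` on the boundary, the interpolation on the collar is from `y`
  -- to `y` and changes nothing.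
  · by_cases h0 : collarWeight s = 0
    · simp [hk, h0]
    · simp [hk, h _ (squeezeCube_mem_boundary_of_collarWeight_ne_zero h0), ← add_smul]

/-! ### Serre fibrations with convex fibers -/

variable [TopologicalSpace Z]

/-- Points whose images are joined by a path are themselves joined by a path. -/
theorem HasConvexFibers.joined_of_joined_map (hc : HasConvexFibers p) (hp : IsSerreFibration p)
    {y₀ y₁ : {v // P v}} (h : Joined (p y₀) (p y₁)) : Joined y₀ y₁ := by
  obtain ⟨γ⟩ := h
  -- The zero-dimensional cube is a point, so this is path lifting. The lift ends in the fiber of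
  -- `y₁`, where a segment leads to `y₁`.
  obtain ⟨K, hK0, hK⟩ := hp.2 0 (ContinuousMap.const _ y₀)
    ⟨fun a => γ a.1, γ.continuous.comp continuous_fst⟩ (fun s => by simp)
  let c : Fin 0 → I := fun _ => 0
  have h1 : p (K (1, c)) = p y₁ := by simp [hK]
  obtain ⟨k, hk, -⟩ := hc.exists_interpolation (X := I) (f := fun _ => K (1, c))
    (g := fun _ => y₁) (t := fun t => (t : ℝ)) continuous_const continuous_const (by fun_prop)
    (fun t => t.2.1) (fun t => t.2.2) (fun t _ => h1)
  have j1 : Joined y₀ (K (1, c)) :=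
    ⟨⟨⟨fun t => K (t, c), K.continuous.comp (Continuous.prodMk_left c)⟩, hK0 c, rfl⟩⟩
  have j2 : Joined (K (1, c)) y₁ :=
    ⟨⟨k, Subtype.ext (by simp [hk]), Subtype.ext (by simp [hk])⟩⟩
  exact j1.trans j2

/-- Scaling the cube to its corner `0` contracts `f`, as a free map, to the base value; the corner
lies on the boundary because `1 ≤ n`. Lifting this homotopy from the constant map gives a lift of
`f` at time `1`. Its boundary lies in the fiber of `p y`, and the collar turns it into a loop over
`squeezeLoop f`. -/
theorem HasConvexFibers.homotopyGroupMap_surjective (hc : HasConvexFibers p)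
    (hp : IsSerreFibration p) {n : ℕ} (hn : 1 ≤ n) (y : {v // P v}) :
    Function.Surjective (homotopyGroupMap ⟨p, hp.1⟩ n y) := by
  intro b
  induction b using Quotient.inductionOn with | _ f
  obtain ⟨K, hK0, hK⟩ := hp.2 n (ContinuousMap.const _ y)
    ⟨fun a => f (fun i => a.1 * a.2 i), f.1.continuous.comp (by fun_prop)⟩
    (fun s => f.2 _ ⟨⟨0, hn⟩, Or.inl (zero_mul _)⟩)
  have hK1 : ∀ s, p (K (1, s)) = f s := fun s => by
    rw [hK]
    exact congrArg f (funext fun i => one_mul _)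
  obtain ⟨L, hLb, -, hLp⟩ := hc.exists_collar (X := Unit) (L := fun a => K (1, a.2))
    (K.continuous.comp (by fun_prop)) y (fun t s hs => (hK1 s).trans (f.2 s hs))
  refine ⟨Quotient.mk _ ⟨⟨fun s => L ((), s), L.continuous.comp (by fun_prop)⟩,
    fun s hs => hLb () s hs⟩, ?_⟩
  refine Quotient.sound ?_
  refine GenLoop.Homotopic.trans ?_ (homotopic_squeezeLoop f).symm
  convert! GenLoop.Homotopic.refl (squeezeLoop f) using 1
  ext s
  exact (hLp () s).trans (hK1 _)

/-- A homotopy between the images lifts to one from `f` to a map in the same fibers as `g`, and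
segments lead on to `g`. Throughout, the boundary stays in the fiber of `p y`, so the collar makes
the homotopy relative to the boundary, at the cost of squeezing both ends. -/
theorem HasConvexFibers.homotopyGroupMap_injective (hc : HasConvexFibers p)
    (hp : IsSerreFibration p) (n : ℕ) (y : {v // P v}) :
    Function.Injective (homotopyGroupMap ⟨p, hp.1⟩ n y) := by
  intro a b hab
  induction a using Quotient.inductionOn with | _ f
  induction b using Quotient.inductionOn with | _ g
  obtain ⟨H⟩ : GenLoop.Homotopic (genLoopMap ⟨p, hp.1⟩ n y f) (genLoopMap ⟨p, hp.1⟩ n y g) :=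
    Quotient.exact hab
  obtain ⟨K, hK0, hK⟩ := hp.2 n f.1 ⟨H, H.continuous⟩ (fun s => H.apply_zero s)
  have hK1 : ∀ s, p (K (1, s)) = p (g s) := fun s => (hK _).trans (H.apply_one s)
  have hKb : ∀ t, ∀ s ∈ Cube.boundary (Fin n), p (K (t, s)) = p y := fun t s hs =>
    ((hK _).trans (H.eq_fst t hs)).trans (congrArg p (f.2 s hs))
  -- The first half of the time interval runs through `K`; in the second half `u` rests at `1` and
  -- the weight `2t - 1` moves to `g`.
  let u : I → I := fun t => Set.projIcc 0 1 zero_le_one (2 * (t : ℝ))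
  have hu : Continuous u := continuous_projIcc.comp (by fun_prop)
  obtain ⟨L, hL, hLp⟩ := hc.exists_interpolation (X := I × (Fin n → I))
    (f := fun a => K (u a.1, a.2)) (g := fun a => g a.2) (t := fun a => max (2 * (a.1 : ℝ) - 1) 0)
    (K.continuous.comp ((hu.comp continuous_fst).prodMk continuous_snd))
    (g.1.continuous.comp continuous_snd) (by fun_prop) (fun a => le_max_right _ _)
    (fun a => max_le (by linarith [a.1.2.2]) zero_le_one) (fun a ha => by
      have h1 : u a.1 = 1 := Set.projIcc_of_right_le _ (by
        by_contra h
        exact ha (max_eq_right (by linarith)))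
      rw [h1, hK1])
  have hL0 : ∀ s, L (0, s) = f s := fun s => Subtype.ext (by
    have : u 0 = 0 := Set.projIcc_of_le_left _ (by simp)
    rw [hL]
    simp [this, hK0])
  have hL1 : ∀ s, L (1, s) = g s := fun s => Subtype.ext (by
    rw [hL]
    norm_num)
  obtain ⟨L', hb, he, -⟩ := hc.exists_collar L.continuous y
    (fun t s hs => (hLp _).trans (hKb _ s hs))
  refine Quotient.sound ((homotopic_squeezeLoop f).trans
    (GenLoop.Homotopic.trans ?_ (homotopic_squeezeLoop g).symm))
  refine genLoop_homotopic_of_map L' (fun s => ?_) (fun s => ?_) hb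
  · rw [he 0 s fun s hs => (hL0 s).trans (f.2 s hs), hL0]
    rfl
  · rw [he 1 s fun s hs => (hL1 s).trans (g.2 s hs), hL1]
    rfl

/-- A surjective Serre fibration with convex fibers is a weak homotopy equivalence. -/
theorem HasConvexFibers.isWeakHomotopyEquiv (hc : HasConvexFibers p)
    (hs : Function.Surjective p) (hp : IsSerreFibration p) : IsWeakHomotopyEquiv p := by
  refine ⟨hp.1, ⟨fun a b hab => ?_, fun c => ?_⟩, fun n hn y =>
    ⟨hc.homotopyGroupMap_injective hp n y, hc.homotopyGroupMap_surjective hp hn y⟩⟩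
  · induction a using Quotient.inductionOn with | _ y₀
    induction b using Quotient.inductionOn with | _ y₁
    exact Quotient.sound (hc.joined_of_joined_map hp (Quotient.exact hab))
  · induction c using Quotient.inductionOn with | _ z
    obtain ⟨y, rfl⟩ := hs z
    exact ⟨Quotient.mk _ y, rfl⟩

end ConvexFibers

/-! ### Expectations and ground states of matrices -/

section Expectation

variable {c c' ι : Type*} [Fintype c] [Fintype c'] [Fintype ι]

theorem normSq_eq_sum (v : c → ℂ) : normSq v = ∑ i, ‖v i‖ ^ 2 := by
  simp only [normSq, dotProduct, Pi.star_apply, Complex.re_sum]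
  refine Finset.sum_congr rfl fun i _ => ?_
  rw [← Complex.normSq_eq_norm_sq, Complex.normSq_apply]
  simp

theorem normSq_nonneg (v : c → ℂ) : 0 ≤ normSq v := by
  rw [normSq_eq_sum]
  positivity

theorem normSq_pos {v : c → ℂ} (hv : v ≠ 0) : 0 < normSq v := by
  obtain ⟨i, hi⟩ := Function.ne_iff.1 hv
  rw [normSq_eq_sum]
  exact Finset.sum_pos' (fun i _ => by positivity)
    ⟨i, Finset.mem_univ i, by have : 0 < ‖v i‖ := norm_pos_iff.2 hi
                              positivity⟩

theorem star_dotProduct_self (v : c → ℂ) : star v ⬝ᵥ v = (normSq v : ℂ) := by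
  rw [normSq_eq_sum]
  push_cast
  refine Finset.sum_congr rfl fun i _ => ?_
  rw [← Complex.conj_mul', Pi.star_apply, starRingEnd_apply]

theorem star_dotProduct_mulVec (A : Matrix c c' ℂ) (v : c → ℂ) (w : c' → ℂ) :
    star v ⬝ᵥ (A *ᵥ w) = star (Aᴴ *ᵥ v) ⬝ᵥ w := by
  rw [Matrix.star_mulVec, Matrix.conjTranspose_conjTranspose, Matrix.dotProduct_mulVec]

theorem star_dotProduct_comm (v w : c → ℂ) : star (star v ⬝ᵥ w) = star w ⬝ᵥ v := by
  rw [Matrix.star_dotProduct, star_star]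

theorem expect_eq_of_eigenvector {A : Matrix c c ℂ} {ψ : c → ℂ} {E : ℝ}
    (h : A *ᵥ ψ = (E : ℂ) • ψ) : expect A ψ = E * normSq ψ := by
  rw [expect, h, dotProduct_smul, star_dotProduct_self, smul_eq_mul, ← Complex.ofReal_mul,
    Complex.ofReal_re]

theorem expect_conjugate (A : Matrix c c ℂ) (M : Matrix c' c ℂ) (v : c' → ℂ) :
    expect (M * A * Mᴴ) v = expect A (Mᴴ *ᵥ v) := by
  rw [expect, expect, ← Matrix.mulVec_mulVec, ← Matrix.mulVec_mulVec, star_dotProduct_mulVec]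

theorem expect_smul_one_sub [DecidableEq c] (C : ℝ) (A : Matrix c c ℂ) (v : c → ℂ) :
    expect (C • (1 : Matrix c c ℂ) - A) v = C * normSq v - expect A v := by
  rw [expect, Matrix.sub_mulVec, Matrix.smul_mulVec, Matrix.one_mulVec, dotProduct_sub,
    dotProduct_smul, Complex.sub_re, Complex.smul_re, smul_eq_mul, normSq, expect]

theorem exists_orthogonal_decomposition {ψ : c → ℂ} (hψ : ψ ≠ 0) (φ : c → ℂ) :
    ∃ (a : ℂ) (w : c → ℂ), φ = a • ψ + w ∧ star ψ ⬝ᵥ w = 0 := by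
  refine ⟨(star ψ ⬝ᵥ φ) / (normSq ψ : ℂ), φ - ((star ψ ⬝ᵥ φ) / (normSq ψ : ℂ)) • ψ,
    by simp, ?_⟩
  have : (normSq ψ : ℂ) ≠ 0 := Complex.ofReal_ne_zero.2 (normSq_pos hψ).ne'
  rw [dotProduct_sub, dotProduct_smul, star_dotProduct_self, smul_eq_mul, div_mul_cancel₀ _ this,
    sub_self]

theorem normSq_add_of_orthogonal {ψ w : c → ℂ} (h : star ψ ⬝ᵥ w = 0) :
    normSq (ψ + w) = normSq ψ + normSq w := by
  have h' : star w ⬝ᵥ ψ = 0 := by rw [← star_dotProduct_comm, h, star_zero]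
  rw [normSq, star_add, add_dotProduct, dotProduct_add, dotProduct_add, h, h']
  simp [normSq]

theorem IsGroundVector.smul {A : Matrix c c ℂ} {ψ : c → ℂ} (h : IsGroundVector A ψ) {a : ℂ}
    (ha : a ≠ 0) : IsGroundVector A (a • ψ) := by
  obtain ⟨h0, E, hE, hv⟩ := h
  exact ⟨smul_ne_zero ha h0, E, by rw [Matrix.mulVec_smul, hE, smul_comm], hv⟩

/-- For a Hermitian matrix, the vector in the definition of the gap is a ground state vector. -/
theorem isGroundVector_of_gap {A : Matrix c c ℂ} (hA : A.IsHermitian) {ψ : c → ℂ} {E Δ : ℝ}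
    (hΔ : 0 ≤ Δ) (h0 : ψ ≠ 0) (hE : A *ᵥ ψ = (E : ℂ) • ψ)
    (hv : ∀ v, star ψ ⬝ᵥ v = 0 → (E + Δ) * normSq v ≤ expect A v) : IsGroundVector A ψ := by
  refine ⟨h0, E, hE, fun v => ?_⟩
  obtain ⟨a, w, rfl, hw⟩ := exists_orthogonal_decomposition h0 v
  have hE' : A *ᵥ (a • ψ) = (E : ℂ) • (a • ψ) := by rw [Matrix.mulVec_smul, hE, smul_comm]
  have haw : star (a • ψ) ⬝ᵥ w = 0 := by rw [star_smul, smul_dotProduct, hw, smul_zero]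
  have hwa : star w ⬝ᵥ (a • ψ) = 0 := by rw [← star_dotProduct_comm, haw, star_zero]
  have hsum : expect A (a • ψ + w) = E * normSq (a • ψ) + expect A w := by
    have hcross : star (a • ψ) ⬝ᵥ (A *ᵥ w) = 0 := by
      rw [star_dotProduct_mulVec, hA.eq, hE', star_smul, smul_dotProduct, haw, smul_zero]
    have hcross' : star w ⬝ᵥ (A *ᵥ (a • ψ)) = 0 := by
      rw [hE', dotProduct_smul, hwa, smul_zero]
    rw [← expect_eq_of_eigenvector hE', expect, Matrix.mulVec_add, star_add, add_dotProduct,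
      dotProduct_add, dotProduct_add, hcross, hcross', add_zero, zero_add, Complex.add_re, expect,
      expect]
  rw [normSq_add_of_orthogonal haw, hsum]
  have := hv w hw
  nlinarith [normSq_nonneg w]

/-- With a gap, the ground state vector is unique up to a factor. -/
theorem IsGroundVector.eq_smul_of_gap {A : Matrix c c ℂ} {ψ φ : c → ℂ} {E Δ : ℝ} (hΔ : 0 < Δ)
    (h0 : ψ ≠ 0) (hE : A *ᵥ ψ = (E : ℂ) • ψ)
    (hv : ∀ v, star ψ ⬝ᵥ v = 0 → (E + Δ) * normSq v ≤ expect A v) (hφ : IsGroundVector A φ) :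
    ∃ a : ℂ, a ≠ 0 ∧ φ = a • ψ := by
  obtain ⟨hφ0, E', hE', hv'⟩ := hφ
  obtain ⟨a, w, rfl, hw⟩ := exists_orthogonal_decomposition h0 φ
  have hle : E' ≤ E := by
    have := hv' ψ
    rw [expect_eq_of_eigenvector hE] at this
    exact le_of_mul_le_mul_right this (normSq_pos h0)
  have hwψ : star w ⬝ᵥ ψ = 0 := by rw [← star_dotProduct_comm, hw, star_zero]
  -- Pairing this with `w` removes the multiples of `ψ`, so `w` has energy `E' ≤ E` per unit norm,
  -- against the bound `E + Δ` unless `w = 0`.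
  have hAw : A *ᵥ w = (E' : ℂ) • (a • ψ + w) - (a * E) • ψ := by
    rw [← hE', Matrix.mulVec_add, Matrix.mulVec_smul, hE, smul_smul]
    abel
  have hexp : expect A w = E' * normSq w := by
    rw [expect, hAw, dotProduct_sub, dotProduct_smul, dotProduct_smul, dotProduct_add,
      dotProduct_smul, hwψ, star_dotProduct_self]
    simp
  have hw0 : w = 0 := by
    by_contra hne
    have := hv w hw
    rw [hexp] at this
    have := le_of_mul_le_mul_right this (normSq_pos hne)
    linarith
  subst hw0
  rw [add_zero] at hφ0 ⊢
  exact ⟨a, fun ha => hφ0 (by rw [ha, zero_smul]), rfl⟩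

/-- The gap is a gap above any ground state vector. -/
theorem HasGap.gap_above {A : Matrix c c ℂ} {Δ : ℝ} (h : HasGap A Δ) (hΔ : 0 < Δ) {φ : c → ℂ}
    (hφ : IsGroundVector A φ) :
    ∃ E : ℝ, A *ᵥ φ = (E : ℂ) • φ ∧
      ∀ v, star φ ⬝ᵥ v = 0 → (E + Δ) * normSq v ≤ expect A v := by
  obtain ⟨ψ, E, h0, hE, hv⟩ := h
  obtain ⟨a, ha, rfl⟩ := hφ.eq_smul_of_gap hΔ h0 hE hv
  refine ⟨E, by rw [Matrix.mulVec_smul, hE, smul_comm], fun v hvv => hv v ?_⟩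
  rw [star_smul, smul_dotProduct, smul_eq_mul, mul_eq_zero] at hvv
  exact hvv.resolve_left (star_ne_zero.2 ha)

theorem HasGap.exists_isGroundVector {A : Matrix c c ℂ} (hA : A.IsHermitian) {Δ : ℝ}
    (h : HasGap A Δ) (hΔ : 0 < Δ) : ∃ ψ, IsGroundVector A ψ := by
  obtain ⟨ψ, E, h0, hE, hv⟩ := h
  exact ⟨ψ, isGroundVector_of_gap hA hΔ.le h0 hE hv⟩

/-- The ground vectors form one punctured line, so exhibiting a single common ground vector shows
that two gapped matrices have the same ground state. -/
theorem HasGap.isGroundVector_iff {A : Matrix c c ℂ} {Δ : ℝ} (h : HasGap A Δ) (hΔ : 0 < Δ)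
    {φ : c → ℂ} (hφ : IsGroundVector A φ) (χ : c → ℂ) :
    IsGroundVector A χ ↔ ∃ a : ℂ, a ≠ 0 ∧ χ = a • φ := by
  refine ⟨fun hχ => ?_, fun ⟨a, ha, e⟩ => e ▸ hφ.smul ha⟩
  obtain ⟨E, hE, hv⟩ := h.gap_above hΔ hφ
  exact hχ.eq_smul_of_gap hΔ hφ.1 hE hv

/-- Interpolation between two Hermitian matrices with the same ground state and with gaps. -/
theorem HasGap.interpolate {A₀ A₁ : Matrix c c ℂ} (h₀ : A₀.IsHermitian) {Δ₀ Δ₁ t : ℝ}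
    (hg₀ : HasGap A₀ Δ₀) (hg₁ : HasGap A₁ Δ₁) (hΔ₀ : 0 < Δ₀) (hΔ₁ : 0 < Δ₁)
    (h : ∀ ψ, IsGroundVector A₀ ψ ↔ IsGroundVector A₁ ψ) (ht0 : 0 ≤ t) (ht1 : t ≤ 1) :
    HasGap ((1 - t) • A₀ + t • A₁) ((1 - t) * Δ₀ + t * Δ₁) ∧
      ∀ ψ, IsGroundVector A₀ ψ → IsGroundVector ((1 - t) • A₀ + t • A₁) ψ := by
  have hexp : ∀ v, expect ((1 - t) • A₀ + t • A₁) v = (1 - t) * expect A₀ v + t * expect A₁ v :=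
    fun v => by rw [expect_add, expect_smul, expect_smul]
  have heig : ∀ {ψ : c → ℂ} {E₀ E₁ : ℝ}, A₀ *ᵥ ψ = (E₀ : ℂ) • ψ → A₁ *ᵥ ψ = (E₁ : ℂ) • ψ →
      ((1 - t) • A₀ + t • A₁) *ᵥ ψ = (((1 - t) * E₀ + t * E₁ : ℝ) : ℂ) • ψ := by
    intro ψ E₀ E₁ e₀ e₁
    rw [Matrix.add_mulVec, Matrix.smul_mulVec, Matrix.smul_mulVec, e₀, e₁]
    ext i
    simp
    ring
  have ht1' : 0 ≤ 1 - t := sub_nonneg.2 ht1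
  constructor
  · obtain ⟨φ, hφ⟩ := hg₀.exists_isGroundVector h₀ hΔ₀
    obtain ⟨E₀, e₀, v₀⟩ := hg₀.gap_above hΔ₀ hφ
    obtain ⟨E₁, e₁, v₁⟩ := hg₁.gap_above hΔ₁ ((h φ).1 hφ)
    refine ⟨φ, (1 - t) * E₀ + t * E₁, hφ.1, heig e₀ e₁, fun v hv => ?_⟩
    rw [hexp]
    have a := mul_le_mul_of_nonneg_left (v₀ v hv) ht1'
    have b := mul_le_mul_of_nonneg_left (v₁ v hv) ht0
    linarith
  · intro ψ hψ
    obtain ⟨E₀, e₀, v₀⟩ := hψ.2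
    obtain ⟨E₁, e₁, v₁⟩ := ((h ψ).1 hψ).2
    refine ⟨hψ.1, (1 - t) * E₀ + t * E₁, heig e₀ e₁, fun v => ?_⟩
    rw [hexp]
    have a := mul_le_mul_of_nonneg_left (v₀ v) ht1'
    have b := mul_le_mul_of_nonneg_left (v₁ v) ht0
    linarith

/-! #### Resolutions of the identity -/

variable {W : ι → Matrix c' c ℂ} [DecidableEq c]

theorem sum_normSq_of_resolution (hW : ∑ i, (W i)ᴴ * W i = 1) (v : c → ℂ) :
    ∑ i, normSq (W i *ᵥ v) = normSq v := by
  have : ∀ i, normSq (W i *ᵥ v) = (star v ⬝ᵥ (((W i)ᴴ * W i) *ᵥ v)).re := fun i => by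
    rw [← Matrix.mulVec_mulVec, star_dotProduct_mulVec, Matrix.conjTranspose_conjTranspose, normSq]
  simp_rw [this]
  rw [← Complex.re_sum, ← dotProduct_sum, ← Matrix.sum_mulVec, hW, Matrix.one_mulVec, normSq]

/-- Insert the resolution of the identity in front of `A` and move `A` through each `W i`. A lower
bound on the energy for `A` thus reduces to bounds for the `N i`, which may act on a different
space. -/
theorem sum_expect_of_resolution (hW : ∑ i, (W i)ᴴ * W i = 1) {A : Matrix c c ℂ}
    {N : ι → Matrix c' c' ℂ} (hN : ∀ i, W i * A = N i * W i) (v : c → ℂ) :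
    ∑ i, expect (N i) (W i *ᵥ v) = expect A v := by
  have : ∀ i, expect (N i) (W i *ᵥ v) = (star v ⬝ᵥ (((W i)ᴴ * W i * A) *ᵥ v)).re := fun i => by
    rw [Matrix.mul_assoc, ← Matrix.mulVec_mulVec, star_dotProduct_mulVec,
      Matrix.conjTranspose_conjTranspose, hN, expect, Matrix.mulVec_mulVec]
  simp_rw [this]
  rw [← Complex.re_sum, ← dotProduct_sum, ← Matrix.sum_mulVec, ← Finset.sum_mul, hW,
    Matrix.one_mul, expect]

end Expectation

/-! ### Operators on tensor products -/

section Tensor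

variable {α β ι : Type*} [Fintype α] [Fintype β] [DecidableEq α] [DecidableEq β] {q m n k : ℕ}

theorem tensorOp_mul (A : α → Matrix (Fin m) (Fin n) ℂ) (A' : α → Matrix (Fin n) (Fin k) ℂ) :
    tensorOp A * tensorOp A' = tensorOp fun x => A x * A' x := by
  ext σ τ
  simp only [tensorOp, Matrix.mul_apply, Matrix.of_apply, ← Finset.prod_mul_distrib]
  rw [Finset.prod_univ_sum, Fintype.piFinset_univ]

omit [DecidableEq α] in
theorem tensorOp_conjTranspose (A : α → Matrix (Fin m) (Fin n) ℂ) :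
    (tensorOp A)ᴴ = tensorOp fun x => (A x)ᴴ := by
  ext σ τ
  simp [tensorOp, Matrix.conjTranspose_apply]

omit [DecidableEq α] in
theorem tensorOp_one : tensorOp (fun _ : α => (1 : Matrix (Fin m) (Fin m) ℂ)) = 1 := by
  ext σ τ
  simp only [tensorOp, Matrix.of_apply, Matrix.one_apply, Finset.prod_ite_zero, funext_iff]
  simp

omit [DecidableEq α] in
theorem tensorOp_eq_zero {A : α → Matrix (Fin m) (Fin n) ℂ} {x : α} (h : A x = 0) :
    tensorOp A = 0 := by
  ext σ τ
  exact Finset.prod_eq_zero (Finset.mem_univ x) (by rw [h]; rfl)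

theorem sum_tensorOp [Fintype ι] (A : α → ι → Matrix (Fin m) (Fin n) ℂ) :
    ∑ τ : α → ι, tensorOp (fun x => A x (τ x)) = tensorOp fun x => ∑ i, A x i := by
  ext ρ σ
  simp only [Matrix.sum_apply, tensorOp, Matrix.of_apply]
  rw [Finset.prod_univ_sum, Fintype.piFinset_univ]

omit [DecidableEq α] in
theorem twist_tensorOp (s : ℤˣ) (A : α → Matrix (Fin m) (Fin n) ℂ) :
    twist s (tensorOp A) = tensorOp fun x => twist s (A x) := by
  unfold twist
  split_ifs
  · rfl
  · ext σ τ
    simp [tensorOp]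

theorem twist_mul {a b c : Type*} [Fintype b] (s : ℤˣ) (A : Matrix a b ℂ) (A' : Matrix b c ℂ) :
    twist s (A * A') = twist s A * twist s A' := by
  unfold twist
  split_ifs
  · rfl
  · exact Matrix.map_mul

theorem twist_conjTranspose {a b : Type*} (s : ℤˣ) (A : Matrix a b ℂ) :
    twist s Aᴴ = (twist s A)ᴴ := by
  unfold twist
  split_ifs
  · rfl
  · ext i j
    simp

theorem twist_one {a : Type*} [DecidableEq a] (s : ℤˣ) :
    twist s (1 : Matrix a a ℂ) = 1 := by
  unfold twist
  split_ifs
  · rfl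
  · exact Matrix.map_one _ (map_zero _) (map_one _)

/-- A configuration prescribed off the image of `f` is determined by its values on the image. This
reduces products with `embedOp` to sums over configurations of `α`. -/
theorem sum_ite_eq_off_range (f : α ↪ β) (τ : β → Fin q) (F : (β → Fin q) → ℂ) :
    (∑ σ, if ∀ b, b ∉ Set.range f → σ b = τ b then F σ else 0) =
      ∑ ρ : α → Fin q, F (Function.extend f ρ τ) := by
  rw [← Finset.sum_filter]
  have hext : ∀ σ : β → Fin q, (∀ b, b ∉ Set.range f → σ b = τ b) →
      Function.extend f (fun a => σ (f a)) τ = σ := by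
    intro σ hσ
    funext b
    by_cases hb : b ∈ Set.range f
    · obtain ⟨a, rfl⟩ := hb
      exact f.injective.extend_apply _ _ a
    · rw [Function.extend_apply' _ _ _ hb, hσ b hb]
  refine Finset.sum_nbij' (fun σ a => σ (f a)) (fun ρ => Function.extend f ρ τ) ?_ ?_ ?_ ?_ ?_
  · exact fun _ _ => Finset.mem_univ _
  · exact fun ρ _ => Finset.mem_filter.2
      ⟨Finset.mem_univ _, fun b hb => Function.extend_apply' _ _ _ hb⟩
  · exact fun σ hσ => hext σ (Finset.mem_filter.1 hσ).2
  · exact fun ρ _ => funext fun a => f.injective.extend_apply _ _ a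
  · exact fun σ hσ => by rw [hext σ (Finset.mem_filter.1 hσ).2]

theorem embedOp_mul (f : α ↪ β) (A A' : Op α q) :
    embedOp f (A * A') = embedOp f A * embedOp f A' := by
  ext σ τ
  have h1 : (embedOp f A * embedOp f A') σ τ = ∑ σ', if ∀ b, b ∉ Set.range f → σ' b = τ b then
      embedOp f A σ σ' * A' (fun a => σ' (f a)) (fun a => τ (f a)) else 0 := by
    rw [Matrix.mul_apply]
    refine Finset.sum_congr rfl fun σ' _ => ?_
    simp only [embedOp, Matrix.of_apply, mul_ite, mul_zero]
  rw [h1, sum_ite_eq_off_range]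
  have hoff : ∀ ρ : α → Fin q, (∀ b, b ∉ Set.range f → σ b = Function.extend f ρ τ b) ↔
      ∀ b, b ∉ Set.range f → σ b = τ b := fun ρ =>
    forall₂_congr fun b hb => by rw [Function.extend_apply' _ _ _ hb]
  simp only [embedOp, Matrix.of_apply, hoff, f.injective.extend_apply, Matrix.mul_apply]
  split_ifs <;> simp

omit [Fintype α] [Fintype β] [DecidableEq α] [DecidableEq β] in
theorem embedOp_conjTranspose (f : α ↪ β) (A : Op α q) : embedOp f Aᴴ = (embedOp f A)ᴴ := by
  ext σ τ
  simp only [embedOp, Matrix.of_apply, Matrix.conjTranspose_apply, apply_ite star, star_zero,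
    eq_comm]

omit [Fintype α] [Fintype β] [DecidableEq α] [DecidableEq β] in
theorem embedOp_zero (f : α ↪ β) : embedOp f (0 : Op α q) = 0 := by
  ext σ τ
  simp [embedOp]

omit [DecidableEq α] in
theorem embedOp_one (f : α ↪ β) : embedOp f (1 : Op α q) = 1 := by
  ext σ τ
  by_cases h : σ = τ
  · subst h
    simp [embedOp]
  · rw [Matrix.one_apply_ne h, embedOp, Matrix.of_apply]
    split_ifs with h1
    swap
    · rfl
    refine Matrix.one_apply_ne fun h2 => h (funext fun b => ?_)
    by_cases hb : b ∈ Set.range f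
    · obtain ⟨a, rfl⟩ := hb
      exact congrFun h2 a
    · exact h1 b hb

/-- A tensor product of operators intertwines `embedOp f A` and `embedOp f A'` if its restriction
to the factors in the image of `f` intertwines `A` and `A'`. -/
theorem tensorOp_mul_embedOp (f : α ↪ β) (K : β → Matrix (Fin m) (Fin n) ℂ) {A : Op α n}
    {A' : Op α m} (h : tensorOp (fun a => K (f a)) * A = A' * tensorOp fun a => K (f a)) :
    tensorOp K * embedOp f A = embedOp f A' * tensorOp K := by
  ext σ τ
  have hl : (tensorOp K * embedOp f A) σ τ = ∑ σ' : β → Fin n, if ∀ b, b ∉ Set.range f → σ' b = τ b then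
      (∏ b, K b (σ b) (σ' b)) * A (fun a => σ' (f a)) (fun a => τ (f a)) else 0 := by
    rw [Matrix.mul_apply]
    refine Finset.sum_congr rfl fun σ' _ => ?_
    simp only [embedOp, tensorOp, Matrix.of_apply, mul_ite, mul_zero]
  have hr : (embedOp f A' * tensorOp K) σ τ = ∑ σ' : β → Fin m, if ∀ b, b ∉ Set.range f → σ' b = σ b then
      A' (fun a => σ (f a)) (fun a => σ' (f a)) * ∏ b, K b (σ' b) (τ b) else 0 := by
    rw [Matrix.mul_apply]
    refine Finset.sum_congr rfl fun σ' _ => ?_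
    simp only [embedOp, tensorOp, Matrix.of_apply, ite_mul, zero_mul, eq_comm]
  -- The factors off the image of `f` give the same scalar on both sides, which leaves the entries
  -- of the hypothesis `h`.
  have hsplit : ∀ F : β → ℂ, ∏ b, F b =
      (∏ a, F (f a)) * ∏ b ∈ Finset.univ.filter (fun b => b ∉ Set.range f), F b := by
    intro F
    rw [← Finset.prod_filter_mul_prod_filter_not Finset.univ (fun b => b ∈ Set.range f) F]
    congr 1
    rw [← Finset.prod_map Finset.univ f F]
    refine Finset.prod_congr ?_ fun _ _ => rfl
    ext b
    simp
  rw [hl, hr, sum_ite_eq_off_range, sum_ite_eq_off_range]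
  have hent := congrFun₂ h (fun a => σ (f a)) (fun a => τ (f a))
  simp only [Matrix.mul_apply, tensorOp, Matrix.of_apply] at hent
  have hl' : ∀ ρ : α → Fin n, ∏ b, K b (σ b) (Function.extend f ρ τ b) =
      (∏ a, K (f a) (σ (f a)) (ρ a)) *
        ∏ b ∈ Finset.univ.filter (fun b => b ∉ Set.range f), K b (σ b) (τ b) := by
    intro ρ
    rw [hsplit]
    simp only [f.injective.extend_apply]
    congr 1
    refine Finset.prod_congr rfl fun b hb => ?_
    rw [Function.extend_apply' _ _ _ (Finset.mem_filter.1 hb).2]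
  have hr' : ∀ ρ : α → Fin m, ∏ b, K b (Function.extend f ρ σ b) (τ b) =
      (∏ a, K (f a) (ρ a) (τ (f a))) *
        ∏ b ∈ Finset.univ.filter (fun b => b ∉ Set.range f), K b (σ b) (τ b) := by
    intro ρ
    rw [hsplit]
    simp only [f.injective.extend_apply]
    congr 1
    refine Finset.prod_congr rfl fun b hb => ?_
    rw [Function.extend_apply' _ _ _ (Finset.mem_filter.1 hb).2]
  simp only [hl', hr', f.injective.extend_apply]
  simp only [mul_right_comm, ← mul_assoc, ← Finset.sum_mul]
  rw [hent]

open scoped ComplexOrder MatrixOrder Matrix.Norms.L2Operator in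
/-- An upper bound on an operator remains valid after tensoring with the identity. -/
theorem expect_embedOp_le (f : α ↪ β) {A : Op α q} (hA : A.IsHermitian) {C : ℝ}
    (hC : ∀ v, expect A v ≤ C * normSq v) (w : (β → Fin q) → ℂ) :
    expect (embedOp f A) w ≤ C * normSq w := by
  have hherm : (C • (1 : Op α q) - A).IsHermitian := by
    refine Matrix.IsHermitian.sub ?_ hA
    rw [Matrix.IsHermitian, Matrix.conjTranspose_smul, Matrix.conjTranspose_one, star_trivial]
  have hpos : (C • (1 : Op α q) - A).PosSemidef := by
    refine Matrix.PosSemidef.of_dotProduct_mulVec_nonneg hherm fun v => ?_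
    rw [Complex.nonneg_iff]
    constructor
    · have := expect_smul_one_sub C A v
      rw [expect] at this
      rw [this]
      exact sub_nonneg.2 (hC v)
    · have : star (star v ⬝ᵥ ((C • (1 : Op α q) - A) *ᵥ v)) =
          star v ⬝ᵥ ((C • (1 : Op α q) - A) *ᵥ v) := by
        rw [star_dotProduct_comm, star_dotProduct_mulVec, hherm.eq]
      exact (Complex.conj_eq_iff_im.1 this).symm
  -- Positivity is transported as a factorization `Dᴴ * D`, which survives because `embedOp f` is a
  -- unital star homomorphism.
  obtain ⟨D, hD⟩ := CStarAlgebra.nonneg_iff_eq_star_mul_self.1 hpos.nonneg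
  rw [Matrix.star_eq_conjTranspose] at hD
  have h := expect_smul_one_sub C (embedOp f A) w
  have hE : C • (1 : Op β q) - embedOp f A = (embedOp f D)ᴴ * embedOp f D := by
    rw [← embedOp_conjTranspose, ← embedOp_mul, ← hD, sub_eq_iff_eq_add, ← embedOp_add, sub_add_cancel,
      embedOp_smul, embedOp_one]
  rw [hE, expect, ← Matrix.mulVec_mulVec, star_dotProduct_mulVec,
    Matrix.conjTranspose_conjTranspose] at h
  have := normSq_nonneg (embedOp f D *ᵥ w)
  rw [normSq] at this
  linarith

omit [Fintype α] [Fintype β] [DecidableEq α] [DecidableEq β] in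
/-- For a bijection `f`, `embedOp f` is a relabelling of the tensor factors. -/
theorem embedOp_of_surjective (f : α ↪ β) (hf : Function.Surjective f) (A : Op α n) :
    embedOp f A = A.submatrix (fun σ a => σ (f a)) (fun σ a => σ (f a)) := by
  ext σ τ
  simp [embedOp, hf.range_eq]

theorem embedOp_tensorOp_mul (f : α ↪ β) (hf : Function.Surjective f)
    (K : Matrix (Fin m) (Fin n) ℂ) (A : Op α n) :
    embedOp f (tensorOp (fun _ : α => K) * A * (tensorOp fun _ : α => K)ᴴ) =
      tensorOp (fun _ : β => K) * embedOp f A * (tensorOp fun _ : β => K)ᴴ := by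
  have hb : Function.Bijective f := ⟨f.injective, hf⟩
  have hbij : Function.Bijective fun (σ : β → Fin n) (a : α) => σ (f a) :=
    (Equiv.arrowCongr (Equiv.ofBijective f hb) (Equiv.refl (Fin n))).symm.bijective
  have hK : (tensorOp (fun _ : α => K)).submatrix (fun σ a => σ (f a)) (fun σ a => σ (f a)) =
      tensorOp (fun _ : β => K) := by
    ext σ τ
    exact hb.prod_comp fun b => K (σ b) (τ b)
  rw [embedOp_of_surjective f hf, embedOp_of_surjective f hf,
    Matrix.submatrix_mul _ _ _ _ _ hbij, Matrix.submatrix_mul _ _ _ _ _ hbij,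
    ← Matrix.conjTranspose_submatrix, hK]

end Tensor

/-! ### Modifications of Hamiltonians -/

section Modification

variable {d : ℕ} {G : Type*} [Group G] {B : Background d G} {ℓ₀ ℓ : OnSite B}

theorem expect_sum {c ι : Type*} [Fintype c] (s : Finset ι) (A : ι → Matrix c c ℂ) (v : c → ℂ) :
    expect (∑ i ∈ s, A i) v = ∑ i ∈ s, expect (A i) v := by
  simp only [expect, Matrix.sum_mulVec, dotProduct_sum, Complex.re_sum]

theorem isHermitian_finiteHam (T : ThermodynamicLimit B) (h : Ham ℓ) (n : ℕ) :
    (finiteHam T h n).IsHermitian := by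
  rw [Matrix.IsHermitian, finiteHam, Matrix.conjTranspose_sum]
  refine Finset.sum_congr rfl fun X _ => ?_
  rw [← embedOp_conjTranspose, show (h.term X.1)ᴴ = h.term X.1 from h.2.1 X.1]

theorem Inclusion.tensor_isometry (j : Inclusion ℓ₀ ℓ) (α : Type*) [Fintype α] [DecidableEq α] :
    (j.tensor α)ᴴ * j.tensor α = 1 := by
  rw [tensor, tensorOp_conjTranspose, tensorOp_mul]
  simp only [j.isometry, tensorOp_one]

/-- The projection onto the complement of the smaller on-site Hilbert space. -/
def Inclusion.proj (j : Inclusion ℓ₀ ℓ) : Matrix (Fin ℓ.dim) (Fin ℓ.dim) ℂ := 1 - j.V * j.Vᴴ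

theorem Inclusion.proj_conjTranspose (j : Inclusion ℓ₀ ℓ) : j.projᴴ = j.proj := by
  simp [proj, Matrix.conjTranspose_sub, Matrix.conjTranspose_mul]

theorem Inclusion.proj_mul_V (j : Inclusion ℓ₀ ℓ) : j.proj * j.V = 0 := by
  rw [proj, Matrix.sub_mul, Matrix.mul_assoc, j.isometry, Matrix.mul_one, Matrix.one_mul, sub_self]

theorem Inclusion.V_mul_proj (j : Inclusion ℓ₀ ℓ) : j.Vᴴ * j.proj = 0 := by
  rw [proj, Matrix.mul_sub, ← Matrix.mul_assoc, j.isometry, Matrix.mul_one, Matrix.one_mul,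
    sub_self]

theorem Inclusion.proj_mul_proj (j : Inclusion ℓ₀ ℓ) : j.proj * j.proj = j.proj := by
  nth_rewrite 1 [proj]
  rw [Matrix.sub_mul, Matrix.mul_assoc, V_mul_proj, Matrix.mul_zero, sub_zero, Matrix.one_mul]

theorem Inclusion.complement_eq (j : Inclusion ℓ₀ ℓ) (X : Finset B.Site) :
    j.complement X = tensorOp fun _ : X => j.proj := rfl

theorem surjective_actOn (g : G) (X : Finset B.Site) : Function.Surjective (actOn B g X) := by
  rintro ⟨y, hy⟩
  obtain ⟨x, hx, rfl⟩ := Finset.mem_map.1 hy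
  exact ⟨⟨x, hx⟩, rfl⟩

theorem Inclusion.conjugate_extend (j : Inclusion ℓ₀ ℓ) (g : G) {X : Finset B.Site}
    (A : Op X ℓ₀.dim) : conjugate ℓ g (j.extend A) = j.extend (conjugate ℓ₀ g A) := by
  have hR : tensorOp (fun x : X => ℓ.rep g x) * twist (B.sign g) (j.tensor X) =
      j.tensor X * tensorOp (fun x : X => ℓ₀.rep g x) := by
    rw [tensor, twist_tensorOp, tensorOp_mul, tensorOp_mul]
    simp only [j.intertwines]
  have hR' : (twist (B.sign g) (j.tensor X))ᴴ * (tensorOp (fun x : X => ℓ.rep g x))ᴴ =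
      (tensorOp (fun x : X => ℓ₀.rep g x))ᴴ * (j.tensor X)ᴴ := by
    rw [← Matrix.conjTranspose_mul, hR, Matrix.conjTranspose_mul]
  have h : tensorOp (fun x : X => ℓ.rep g x) * twist (B.sign g) (j.extend A) *
      (tensorOp (fun x : X => ℓ.rep g x))ᴴ = j.tensor X * (tensorOp (fun x : X => ℓ₀.rep g x) *
        twist (B.sign g) A * (tensorOp (fun x : X => ℓ₀.rep g x))ᴴ) * (j.tensor X)ᴴ := by
    rw [extend, twist_mul, twist_mul, twist_conjTranspose]
    simp only [← Matrix.mul_assoc, hR]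
    simp only [Matrix.mul_assoc, hR']
  rw [conjugate, h]
  exact embedOp_tensorOp_mul (actOn B g X) (surjective_actOn g X) j.V _

/-- By the intertwining relation and unitarity of both representations, the range projection `V *
Vᴴ` is invariant, hence so is its complement. A penalty constant over the sites is therefore
symmetric. -/
theorem Inclusion.conjugate_complement (j : Inclusion ℓ₀ ℓ) (g : G) (X : Finset B.Site) :
    conjugate ℓ g (j.complement X) = j.complement (X.map (B.act g)) := by
  have hQ : ∀ x, ℓ.rep g x * twist (B.sign g) j.proj * (ℓ.rep g x)ᴴ = j.proj := by
    intro x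
    have h1 : ℓ.rep g x * (ℓ.rep g x)ᴴ = 1 := Matrix.mem_unitaryGroup_iff.1 (ℓ.rep_unitary g x)
    have h2 : ℓ₀.rep g x * (ℓ₀.rep g x)ᴴ = 1 := Matrix.mem_unitaryGroup_iff.1 (ℓ₀.rep_unitary g x)
    have h3 : twist (B.sign g) j.proj = 1 - twist (B.sign g) j.V * (twist (B.sign g) j.V)ᴴ := by
      rw [eq_sub_iff_add_eq, ← twist_conjTranspose, ← twist_mul, ← twist_add, proj, sub_add_cancel,
        twist_one]
    have h4 : (twist (B.sign g) j.V)ᴴ * (ℓ.rep g x)ᴴ = (ℓ₀.rep g x)ᴴ * j.Vᴴ := by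
      rw [← Matrix.conjTranspose_mul, j.intertwines, Matrix.conjTranspose_mul]
    rw [h3, Matrix.mul_sub, Matrix.sub_mul, Matrix.mul_one, h1, ← Matrix.mul_assoc, j.intertwines,
      Matrix.mul_assoc, h4, Matrix.mul_assoc, ← Matrix.mul_assoc (ℓ₀.rep g x), h2, Matrix.one_mul,
      proj]
  rw [conjugate, complement_eq, twist_tensorOp, tensorOp_conjTranspose, tensorOp_mul, tensorOp_mul]
  simp only [hQ]
  rw [embedOp_of_surjective _ (surjective_actOn g X)]
  ext σ τ
  exact Function.Bijective.prod_comp ⟨(actOn B g X).injective, surjective_actOn g X⟩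
    fun y => j.proj (σ y) (τ y)

theorem normSq_mulVec {c c' : Type*} [Fintype c] [Fintype c'] (A : Matrix c' c ℂ) (v : c → ℂ) :
    normSq (A *ᵥ v) = expect (Aᴴ * A) v := by
  rw [expect, ← Matrix.mulVec_mulVec, star_dotProduct_mulVec, Matrix.conjTranspose_conjTranspose,
    normSq]

theorem expect_projection_nonneg {c : Type*} [Fintype c] {R : Matrix c c ℂ}
    (h : R.IsHermitian) (hR : R * R = R) (v : c → ℂ) : 0 ≤ expect R v := by
  have := normSq_nonneg (R *ᵥ v)
  rwa [normSq_mulVec, h.eq, hR] at this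

theorem expect_projection_le {c : Type*} [Fintype c] [DecidableEq c] {R : Matrix c c ℂ}
    (h : R.IsHermitian) (hR : R * R = R) (v : c → ℂ) : expect R v ≤ normSq v := by
  have h1 := expect_smul_one_sub 1 R v
  rw [one_smul, one_mul] at h1
  have h2 := expect_projection_nonneg (R := 1 - R) (Matrix.isHermitian_one.sub h)
    (by rw [Matrix.sub_mul, Matrix.mul_sub, Matrix.mul_sub, hR]; simp) v
  linarith

theorem normSq_conjTranspose_mulVec_le {c c' : Type*} [Fintype c] [Fintype c'] [DecidableEq c]
    [DecidableEq c'] {A : Matrix c' c ℂ} (hA : Aᴴ * A = 1) (v : c' → ℂ) :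
    normSq (Aᴴ *ᵥ v) ≤ normSq v := by
  rw [normSq_mulVec, Matrix.conjTranspose_conjTranspose]
  refine expect_projection_le (Matrix.isHermitian_mul_conjTranspose_self A) ?_ v
  rw [Matrix.mul_assoc, ← Matrix.mul_assoc Aᴴ, hA, Matrix.one_mul]

theorem Inclusion.complement_isHermitian (j : Inclusion ℓ₀ ℓ) (X : Finset B.Site) :
    (j.complement X).IsHermitian := by
  rw [Matrix.IsHermitian, j.complement_eq, tensorOp_conjTranspose]
  simp only [j.proj_conjTranspose]

theorem Inclusion.complement_mul_self (j : Inclusion ℓ₀ ℓ) (X : Finset B.Site) :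
    j.complement X * j.complement X = j.complement X := by
  rw [j.complement_eq, tensorOp_mul]
  simp only [j.proj_mul_proj]

/-- The Hamiltonian `h`, extended by zero, with a penalty `C` for leaving the smaller on-site
Hilbert space at any one site. -/
def Inclusion.modify (j : Inclusion ℓ₀ ℓ) (C : ℝ) (h : Ham ℓ₀) : Interaction B ℓ.dim := fun X =>
  j.extend (h.term X) + if X.card = 1 then C • j.complement X else 0

theorem Inclusion.isLocalSymmetric_modify (j : Inclusion ℓ₀ ℓ) (C : ℝ) (h : Ham ℓ₀) :
    IsLocalSymmetric ℓ (j.modify C h) := by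
  obtain ⟨h1, h2, ⟨c, h3⟩, h4⟩ := h.2
  refine ⟨fun X => ?_, fun X hX => ?_, ⟨|c| + |C|, fun X v => ?_⟩, fun g X => ?_⟩
  · refine Matrix.IsHermitian.add (Matrix.isHermitian_mul_mul_conjTranspose _ (h1 X)) ?_
    split_ifs
    · rw [Matrix.IsHermitian, Matrix.conjTranspose_smul, (j.complement_isHermitian X).eq,
        star_trivial]
    · exact Matrix.isHermitian_zero
  · have hX₀ : h.term X = 0 := h2 X fun hlt => hX (hlt.trans_le j.range_le)
    -- Singletons have diameter `0`, below the positive range, so the penalty never violates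
    -- locality.
    have hcard : X.card ≠ 1 := by
      intro hc
      obtain ⟨x, rfl⟩ := Finset.card_eq_one.1 hc
      refine hX ?_
      rw [Background.size, Finset.coe_singleton, Set.image_singleton, Metric.diam_singleton]
      exact ℓ.range_pos
    rw [modify, if_neg hcard, hX₀, extend, Matrix.mul_zero, Matrix.zero_mul, add_zero]
  · have e1 : |expect (j.extend (h.term X)) v| ≤ |c| * normSq v := by
      rw [extend, expect_conjugate]
      calc _ ≤ c * normSq ((j.tensor X)ᴴ *ᵥ v) := h3 X _
        _ ≤ |c| * normSq ((j.tensor X)ᴴ *ᵥ v) :=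
          mul_le_mul_of_nonneg_right (le_abs_self c) (normSq_nonneg _)
        _ ≤ |c| * normSq v := mul_le_mul_of_nonneg_left
          (normSq_conjTranspose_mulVec_le (j.tensor_isometry X) v) (abs_nonneg c)
    have e2 : |expect (if X.card = 1 then C • j.complement X else 0) v| ≤ |C| * normSq v := by
      split_ifs
      · rw [expect_smul, abs_mul, abs_of_nonneg
          (expect_projection_nonneg (j.complement_isHermitian X) (j.complement_mul_self X) v)]
        exact mul_le_mul_of_nonneg_left
          (expect_projection_le (j.complement_isHermitian X) (j.complement_mul_self X) v)
          (abs_nonneg C)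
      · simpa [expect] using mul_nonneg (abs_nonneg C) (normSq_nonneg v)
    rw [modify, expect_add]
    refine (abs_add_le _ _).trans ?_
    linarith
  · have h4' : h.term (X.map (B.act g)) = conjugate ℓ₀ g (h.term X) := h4 g X
    have hz : conjugate ℓ g (0 : Op X ℓ.dim) = 0 := by
      simpa using conjugate_smul ℓ g (0 : ℝ) (0 : Op X ℓ.dim)
    simp only [modify, h4', conjugate_add, j.conjugate_extend, Finset.card_map]
    split_ifs
    · rw [conjugate_smul, j.conjugate_complement]
    · rw [hz]

/-! #### Kraus operators

The resolution of the identity of the larger on-site Hilbert space by the adjoint of the inclusion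
and operators of rank one that detect a component orthogonal to the smaller one. -/

/-- The Kraus operators `Vᴴ` and `|a⟩⟨i| (1 - V Vᴴ)`. -/
def Inclusion.kraus (j : Inclusion ℓ₀ ℓ) (a : Fin ℓ₀.dim) :
    Option (Fin ℓ.dim) → Matrix (Fin ℓ₀.dim) (Fin ℓ.dim) ℂ
  | none => j.Vᴴ
  | some i => Matrix.single a i (1 : ℂ) * j.proj

theorem Inclusion.sum_kraus (j : Inclusion ℓ₀ ℓ) (a : Fin ℓ₀.dim) :
    ∑ i, (j.kraus a i)ᴴ * j.kraus a i = 1 := by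
  have h : ∀ i, (j.kraus a (some i))ᴴ * j.kraus a (some i) =
      j.proj * Matrix.single i i 1 * j.proj := fun i => by
    simp only [kraus]
    rw [Matrix.conjTranspose_mul, Matrix.conjTranspose_single, j.proj_conjTranspose, star_one,
      Matrix.mul_assoc, ← Matrix.mul_assoc (Matrix.single i a 1), Matrix.single_mul_single_same,
      mul_one, ← Matrix.mul_assoc]
  rw [Fintype.sum_option]
  simp only [h]
  rw [← Matrix.sum_mul, ← Matrix.mul_sum, Matrix.sum_single_one, Matrix.mul_one, j.proj_mul_proj]
  simp only [kraus]
  rw [Matrix.conjTranspose_conjTranspose, proj, add_sub_cancel]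

theorem Inclusion.kraus_some_mul_V (j : Inclusion ℓ₀ ℓ) (a : Fin ℓ₀.dim) (i : Fin ℓ.dim) :
    j.kraus a (some i) * j.V = 0 := by
  rw [kraus, Matrix.mul_assoc, j.proj_mul_V, Matrix.mul_zero]

theorem Inclusion.kraus_some_mul_proj (j : Inclusion ℓ₀ ℓ) (a : Fin ℓ₀.dim) (i : Fin ℓ.dim) :
    j.kraus a (some i) * j.proj = j.kraus a (some i) := by
  rw [kraus, Matrix.mul_assoc, j.proj_mul_proj]

variable {Λ : Type*} [Fintype Λ]

/-- Products of the Kraus operators over sites. -/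
def Inclusion.krausTensor (j : Inclusion ℓ₀ ℓ) (σ : Λ → Fin ℓ₀.dim)
    (τ : Λ → Option (Fin ℓ.dim)) : Matrix (Λ → Fin ℓ₀.dim) (Λ → Fin ℓ.dim) ℂ :=
  tensorOp fun y => j.kraus (σ y) (τ y)

theorem Inclusion.sum_krausTensor [DecidableEq Λ] (j : Inclusion ℓ₀ ℓ) (σ : Λ → Fin ℓ₀.dim) :
    ∑ τ, (j.krausTensor σ τ)ᴴ * j.krausTensor σ τ = 1 := by
  simp only [krausTensor, tensorOp_conjTranspose, tensorOp_mul]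
  rw [sum_tensorOp fun y i => (j.kraus (σ y) i)ᴴ * j.kraus (σ y) i]
  simp only [sum_kraus, tensorOp_one]

/-- The local term of the modified Hamiltonian, seen through the Kraus operators with label `τ`. -/
def sectorTerm (C : ℝ) (h : Ham ℓ₀) {X : Finset B.Site} {q : ℕ} (τ : X → Option (Fin q)) : Op X ℓ₀.dim :=
  (if ∀ x, τ x = none then h.term X else 0) +
    if X.card = 1 ∧ ∀ x, τ x ≠ none then C • (1 : Op X ℓ₀.dim) else 0

/-- Sitewise, `Vᴴ` cancels `V` and kills the complement, while an excited Kraus operator kills `V`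
and absorbs the complement projection. So an extended term survives only if no site of `X` is
excited, and a penalty only if its site is. -/
theorem Inclusion.krausTensor_mul_modify (j : Inclusion ℓ₀ ℓ) (C : ℝ) (h : Ham ℓ₀)
    {X : Finset B.Site} (σ : X → Fin ℓ₀.dim) (τ : X → Option (Fin ℓ.dim)) :
    j.krausTensor σ τ * j.modify C h X = sectorTerm C h τ * j.krausTensor σ τ := by
  rw [modify, sectorTerm, Matrix.mul_add, Matrix.add_mul]
  congr 1
  · rw [extend, ← Matrix.mul_assoc, ← Matrix.mul_assoc]
    have hT : j.krausTensor σ τ * j.tensor X = tensorOp fun x => j.kraus (σ x) (τ x) * j.V :=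
      tensorOp_mul _ _
    by_cases hτ : ∀ x, τ x = none
    · rw [if_pos hτ, hT]
      simp only [krausTensor, hτ, kraus, j.isometry, tensorOp_one, Matrix.one_mul, tensor,
        tensorOp_conjTranspose]
    · rw [if_neg hτ, Matrix.zero_mul, hT]
      push Not at hτ
      obtain ⟨x, hx⟩ := hτ
      obtain ⟨i, hi⟩ := Option.ne_none_iff_exists'.1 hx
      rw [tensorOp_eq_zero (x := x) (by rw [hi, kraus_some_mul_V]), Matrix.zero_mul,
        Matrix.zero_mul]
  · by_cases hX : X.card = 1
    swap
    · rw [if_neg hX, if_neg fun h => hX h.1, Matrix.mul_zero, Matrix.zero_mul]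
    have hT : j.krausTensor σ τ * j.complement X =
        tensorOp fun x => j.kraus (σ x) (τ x) * j.proj := tensorOp_mul _ _
    rw [if_pos hX, Matrix.mul_smul, hT]
    by_cases hτ : ∀ x, τ x ≠ none
    · rw [if_pos ⟨hX, hτ⟩, Matrix.smul_mul, Matrix.one_mul, krausTensor]
      congr 2
      funext x
      obtain ⟨i, hi⟩ := Option.ne_none_iff_exists'.1 (hτ x)
      rw [hi, kraus_some_mul_proj]
    · rw [if_neg fun h => hτ h.2, Matrix.zero_mul]
      push Not at hτ
      obtain ⟨x, hx⟩ := hτ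
      rw [tensorOp_eq_zero (x := x) (by rw [hx, kraus, j.V_mul_proj]), smul_zero]

/-- The penalty vanishes on the range of the isometry, so the modified Hamiltonian acts there as the
original one. -/
theorem Inclusion.modify_mul_tensor (j : Inclusion ℓ₀ ℓ) (C : ℝ) (h : Ham ℓ₀)
    (X : Finset B.Site) : j.modify C h X * j.tensor X = j.tensor X * h.term X := by
  rw [modify, Matrix.add_mul, extend, Matrix.mul_assoc, j.tensor_isometry, Matrix.mul_one]
  refine add_eq_left.2 ?_
  split_ifs with hX
  · obtain ⟨x, hx⟩ : X.Nonempty := Finset.card_pos.1 (by omega)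
    have hT : j.complement X * j.tensor X = tensorOp fun _ : X => j.proj * j.V := tensorOp_mul _ _
    rw [Matrix.smul_mul, hT, tensorOp_eq_zero (x := ⟨x, hx⟩) j.proj_mul_V, smul_zero]
  · exact Matrix.zero_mul _

end Modification

/-! ### The gap of a modified Hamiltonian -/

section FiniteVolume

variable {d : ℕ} {G : Type*} [Group G] {B : Background d G} {ℓ₀ ℓ : OnSite B}
  (T : ThermodynamicLimit B)

/-- The modified Hamiltonian in a finite volume, seen through the Kraus operators with label
`τ`. -/
def sectorHam (C : ℝ) (h : Ham ℓ₀) (n : ℕ) {q : ℕ} (τ : T.volume n → Option (Fin q)) :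
    Op (T.volume n) ℓ₀.dim :=
  ∑ X : {X // X ∈ T.terms n}, embedOp (T.place n X.1 X.2)
    (sectorTerm C h fun x => τ (T.place n X.1 X.2 x))

/-- The sites at which the Kraus operators detect a component orthogonal to the smaller on-site
Hilbert space. -/
def excited {n q : ℕ} (τ : T.volume n → Option (Fin q)) : Finset (T.volume n) :=
  Finset.univ.filter fun y => τ y ≠ none

theorem krausTensor_mul_finiteHam (j : Inclusion ℓ₀ ℓ) {C : ℝ} {h : Ham ℓ₀} {h' : Ham ℓ}
    (hh' : h'.term = j.modify C h) {n : ℕ} (σ : T.volume n → Fin ℓ₀.dim)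
    (τ : T.volume n → Option (Fin ℓ.dim)) :
    j.krausTensor σ τ * finiteHam T h' n = sectorHam T C h n τ * j.krausTensor σ τ := by
  rw [finiteHam, sectorHam, Matrix.mul_sum, Matrix.sum_mul]
  refine Finset.sum_congr rfl fun X _ => tensorOp_mul_embedOp _ _ ?_
  rw [hh']
  exact j.krausTensor_mul_modify C h (fun x => σ (T.place n X.1 X.2 x)) _

theorem finiteHam_mul_tensor (j : Inclusion ℓ₀ ℓ) {C : ℝ} {h : Ham ℓ₀} {h' : Ham ℓ}
    (hh' : h'.term = j.modify C h) (n : ℕ) :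
    finiteHam T h' n * j.tensor (T.volume n) = j.tensor (T.volume n) * finiteHam T h n := by
  rw [finiteHam, finiteHam, Matrix.mul_sum, Matrix.sum_mul]
  refine Finset.sum_congr rfl fun X _ => (tensorOp_mul_embedOp _ _ ?_).symm
  rw [hh']
  exact (j.modify_mul_tensor C h X.1).symm

theorem card_terms_touching_le {k : ℝ} {M : ℕ}
    (hM : ∀ (n : ℕ) (y : T.volume n),
      {X : {X // X ∈ T.terms n} | B.size X.1 < k ∧ ∃ x, T.place n X.1 X.2 x = y}.ncard ≤ M)
    (n : ℕ) (S : Finset (T.volume n)) :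
    (Finset.univ.filter fun X : {X // X ∈ T.terms n} =>
      B.size X.1 < k ∧ ∃ x, T.place n X.1 X.2 x ∈ S).card ≤ S.card * M := by
  refine (Finset.card_le_card ?_).trans (Finset.card_biUnion_le_card_mul S (fun y =>
    Finset.univ.filter fun X : {X // X ∈ T.terms n} =>
      B.size X.1 < k ∧ ∃ x, T.place n X.1 X.2 x = y) M fun y _ => ?_)
  · intro X hX
    obtain ⟨-, hk, x, hx⟩ := Finset.mem_filter.1 hX
    exact Finset.mem_biUnion.2 ⟨_, hx, Finset.mem_filter.2 ⟨Finset.mem_univ _, hk, x, rfl⟩⟩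
  · have := hM n y
    rwa [← Set.ncard_coe_finset, Finset.coe_filter_univ]

/-- By `bulk` the singleton term of each site of the volume is kept in place; moved singletons can
only add penalties. -/
theorem card_le_card_singleton_terms (n : ℕ) (S : Finset (T.volume n)) :
    S.card ≤ (Finset.univ.filter fun X : {X // X ∈ T.terms n} =>
      X.1.card = 1 ∧ ∀ x, T.place n X.1 X.2 x ∈ S).card := by
  have hb := fun y : T.volume n => T.bulk n {y.1} (Finset.singleton_subset_iff.2 y.2)
  refine Finset.card_le_card_of_injOn (fun y => ⟨{y.1}, (hb y).choose⟩) (fun y hy => ?_) ?_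
  · refine Finset.mem_coe.2 (Finset.mem_filter.2 ⟨Finset.mem_univ _, Finset.card_singleton _,
      fun x => ?_⟩)
    have : T.place n {y.1} (hb y).choose x = y :=
      Subtype.ext (((hb y).choose_spec x).trans (Finset.mem_singleton.1 x.2))
    rw [this]
    exact hy
  · intro y _ y' _ e
    exact Subtype.ext (Finset.singleton_injective (congrArg Subtype.val e))

/-- Every excited site raises the energy by at least `C - M c`. -/
theorem expect_sectorHam_ge {h : Ham ℓ₀} {c C : ℝ} (hc0 : 0 ≤ c) (hC0 : 0 ≤ C)
    (hc : ∀ X v, expect (h.term X) v ≤ c * normSq v) {M : ℕ}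
    (hM : ∀ (n : ℕ) (y : T.volume n), {X : {X // X ∈ T.terms n} |
      B.size X.1 < ℓ₀.range ∧ ∃ x, T.place n X.1 X.2 x = y}.ncard ≤ M)
    (n : ℕ) {q : ℕ} (τ : T.volume n → Option (Fin q)) (w) :
    expect (finiteHam T h n) w + (C - M * c) * (excited T τ).card * normSq w ≤
      expect (sectorHam T C h n τ) w := by
  have hw := normSq_nonneg w
  -- A term touching an excited site is lost, at a cost of at most `c`; a single-site term on an
  -- excited site contributes `C`. Summed, at most `M` losses and at least one penalty occur per
  -- excited site.
  have hterm : ∀ X : {X // X ∈ T.terms n},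
      expect (embedOp (T.place n X.1 X.2) (h.term X.1)) w
        - (if B.size X.1 < ℓ₀.range ∧ ∃ x, T.place n X.1 X.2 x ∈ excited T τ then
            c * normSq w else 0)
        + (if X.1.card = 1 ∧ ∀ x, T.place n X.1 X.2 x ∈ excited T τ then C * normSq w else 0) ≤
      expect (embedOp (T.place n X.1 X.2)
        (sectorTerm C h fun x => τ (T.place n X.1 X.2 x))) w := by
    intro X
    have hmem : ∀ x, T.place n X.1 X.2 x ∈ excited T τ ↔ τ (T.place n X.1 X.2 x) ≠ none :=
      fun x => by simp [excited]
    rw [sectorTerm, embedOp_add, expect_add]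
    simp only [hmem]
    refine add_le_add ?_ ?_
    · by_cases hτ : ∀ x, τ (T.place n X.1 X.2 x) = none
      · rw [if_pos hτ, if_neg (by rintro ⟨-, x, hx⟩; exact hx (hτ x)), sub_zero]
      · have hz : expect (0 : Op (T.volume n) ℓ₀.dim) w = 0 := by simp [expect]
        rw [if_neg hτ, embedOp_zero, hz, sub_nonpos]
        by_cases hk : B.size X.1 < ℓ₀.range
        · rw [if_pos ⟨hk, not_forall.1 hτ⟩]
          exact expect_embedOp_le _ (h.2.1 X.1) (hc X.1) w
        · have h0 : h.term X.1 = 0 := h.2.2.1 X.1 hk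
          rw [h0, embedOp_zero, hz]
          split_ifs
          · positivity
          · exact le_rfl
    · split_ifs
      · rw [embedOp_smul, embedOp_one, expect_smul, expect, Matrix.one_mulVec, normSq]
      · rw [embedOp_zero]
        simp [expect]
  have hsum := Finset.sum_le_sum fun X (_ : X ∈ Finset.univ) => hterm X
  rw [Finset.sum_add_distrib, Finset.sum_sub_distrib, ← expect_sum, ← expect_sum,
    ← Finset.sum_filter, ← Finset.sum_filter, Finset.sum_const, Finset.sum_const, nsmul_eq_mul,
    nsmul_eq_mul] at hsum
  have h1 : ((Finset.univ.filter fun X : {X // X ∈ T.terms n} => B.size X.1 < ℓ₀.range ∧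
      ∃ x, T.place n X.1 X.2 x ∈ excited T τ).card : ℝ) ≤ (excited T τ).card * M := by
    exact_mod_cast card_terms_touching_le T hM n (excited T τ)
  have h2 : ((excited T τ).card : ℝ) ≤ (Finset.univ.filter fun X : {X // X ∈ T.terms n} =>
      X.1.card = 1 ∧ ∀ x, T.place n X.1 X.2 x ∈ excited T τ).card := by
    exact_mod_cast card_le_card_singleton_terms T n (excited T τ)
  have h3 := mul_le_mul_of_nonneg_right h1 (mul_nonneg hc0 hw)
  have h4 := mul_le_mul_of_nonneg_right h2 (mul_nonneg hC0 hw)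
  refine le_trans ?_ hsum
  rw [← finiteHam]
  linarith

/-- In a finite volume, the modified Hamiltonian has the same gap as the original one, and its
ground state is the image of the original ground state. -/
theorem hasGap_modify (j : Inclusion ℓ₀ ℓ) {h : Ham ℓ₀} {h' : Ham ℓ} {c Δ : ℝ} {M : ℕ}
    (hh' : h'.term = j.modify (M * c + Δ) h) (hc0 : 0 ≤ c) (hΔ : 0 < Δ)
    (hc : ∀ X v, expect (h.term X) v ≤ c * normSq v)
    (hM : ∀ (n : ℕ) (y : T.volume n), {X : {X // X ∈ T.terms n} |
      B.size X.1 < ℓ₀.range ∧ ∃ x, T.place n X.1 X.2 x = y}.ncard ≤ M)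
    {n : ℕ} (hgap : HasGap (finiteHam T h n) Δ) {ψ : (T.volume n → Fin ℓ₀.dim) → ℂ}
    (hψ : IsGroundVector (finiteHam T h n) ψ) :
    HasGap (finiteHam T h' n) Δ ∧
      IsGroundVector (finiteHam T h' n) (j.tensor (T.volume n) *ᵥ ψ) := by
  obtain ⟨E, hE, hv⟩ := hgap.gap_above hΔ hψ
  obtain ⟨E', hE', hv'⟩ := hψ.2
  -- Any configuration serves as the target of the rank-one Kraus operators; `ψ ≠ 0` guarantees that
  -- one exists.
  obtain ⟨σ, -⟩ := Function.ne_iff.1 hψ.1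
  have hEE : E' = E := by
    have h1 := expect_eq_of_eigenvector hE
    rw [expect_eq_of_eigenvector hE'] at h1
    exact mul_right_cancel₀ (normSq_pos hψ.1).ne' h1
  subst hEE
  set J := j.tensor (T.volume n) with hJ
  have hiso : Jᴴ * J = 1 := j.tensor_isometry _
  have h0 : J *ᵥ ψ ≠ 0 := by
    intro e
    apply hψ.1
    rw [← Matrix.one_mulVec ψ, ← hiso, ← Matrix.mulVec_mulVec, e, Matrix.mulVec_zero]
  have heig : finiteHam T h' n *ᵥ (J *ᵥ ψ) = (E' : ℂ) • (J *ᵥ ψ) := by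
    rw [Matrix.mulVec_mulVec, finiteHam_mul_tensor T j hh', ← Matrix.mulVec_mulVec, hE,
      Matrix.mulVec_smul]
  have hgap' : ∀ v, star (J *ᵥ ψ) ⬝ᵥ v = 0 →
      (E' + Δ) * normSq v ≤ expect (finiteHam T h' n) v := by
    intro v hψv
    rw [← sum_normSq_of_resolution (j.sum_krausTensor σ) v,
      ← sum_expect_of_resolution (j.sum_krausTensor σ) (krausTensor_mul_finiteHam T j hh' σ) v,
      Finset.mul_sum]
    refine Finset.sum_le_sum fun τ _ => ?_
    have hlow := expect_sectorHam_ge T hc0 (C := M * c + Δ) (by positivity) hc hM n τ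
      (j.krausTensor σ τ *ᵥ v)
    -- With the penalty `M * c + Δ`, each excited site costs at least `Δ` net.
    rw [add_sub_cancel_left] at hlow
    refine le_trans ?_ hlow
    have hnn := normSq_nonneg (j.krausTensor σ τ *ᵥ v)
    -- Without excitations the Kraus operator is `Jᴴ`, and `Jᴴ *ᵥ v` is orthogonal to `ψ`, so the
    -- original gap applies. Otherwise the ground energy bound plus one excitation gives `E' + Δ`.
    by_cases hτ : τ = fun _ => none
    · have hW : j.krausTensor σ τ = Jᴴ := by
        rw [hτ, hJ, Inclusion.tensor, tensorOp_conjTranspose]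
        rfl
      have := hv (j.krausTensor σ τ *ᵥ v) (by
        rw [hW, star_dotProduct_mulVec, Matrix.conjTranspose_conjTranspose, hψv])
      have hcard : (0 : ℝ) ≤ (excited T τ).card := Nat.cast_nonneg _
      nlinarith [mul_nonneg (mul_nonneg hΔ.le hcard) hnn]
    · have hcard : (1 : ℝ) ≤ (excited T τ).card := by
        obtain ⟨y, hy⟩ := Function.ne_iff.1 hτ
        have : 0 < (excited T τ).card :=
          Finset.card_pos.2 ⟨y, Finset.mem_filter.2 ⟨Finset.mem_univ _, hy⟩⟩
        exact_mod_cast this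
      have h1 := hv' (j.krausTensor σ τ *ᵥ v)
      have h2 := mul_le_mul_of_nonneg_right (mul_le_mul_of_nonneg_left hcard hΔ.le) hnn
      linarith
  exact ⟨⟨_, E', h0, heig, hgap'⟩,
    isGroundVector_of_gap (isHermitian_finiteHam T h' n) hΔ.le h0 heig hgap'⟩

/-- Every gapped Hamiltonian has a modification with respect to any inclusion. -/
theorem exists_isModification (j : Inclusion ℓ₀ ℓ) (h : GappedHam T ℓ₀) :
    ∃ h' : GappedHam T ℓ, IsModification T j h h' := by
  obtain ⟨Δ, hΔ, hgap⟩ := h.2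
  obtain ⟨c, hc⟩ := h.1.2.2.2.1
  obtain ⟨M, hM⟩ := T.multiplicity ℓ₀.range
  have hc' : ∀ X v, expect (h.1.term X) v ≤ |c| * normSq v := fun X v =>
    ((le_abs_self _).trans (hc X v)).trans
      (mul_le_mul_of_nonneg_right (le_abs_self c) (normSq_nonneg v))
  have hC : 0 < M * |c| + Δ := by positivity
  let k : Ham ℓ := ⟨j.modify (M * |c| + Δ) h.1, j.isLocalSymmetric_modify _ h.1⟩
  have key : ∀ᶠ n in atTop, ∀ ψ, IsGroundVector (finiteHam T h.1 n) ψ →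
      HasGap (finiteHam T k n) Δ ∧
        IsGroundVector (finiteHam T k n) (j.tensor (T.volume n) *ᵥ ψ) :=
    hgap.mono fun n hn ψ hψ => hasGap_modify T j (h' := k) rfl (abs_nonneg c) hΔ hc' hM hn hψ
  refine ⟨⟨k, Δ, hΔ, ?_⟩, ⟨fun _ => M * |c| + Δ, fun _ => hC, fun x => ?_, fun X hX => ?_⟩, ?_⟩
  · filter_upwards [key, hgap] with n hn hg
    obtain ⟨ψ, hψ⟩ := hg.exists_isGroundVector (isHermitian_finiteHam T h.1 n) hΔ
    exact (hn ψ hψ).1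
  · show j.modify _ h.1 {x} = _
    rw [Inclusion.modify, if_pos (Finset.card_singleton x)]
  · show j.modify _ h.1 X = _
    rw [Inclusion.modify, if_neg hX, add_zero]
  · exact key.mono fun n hn ψ hψ => (hn ψ hψ).2

end FiniteVolume

/-! ### Ground states and phases -/

section Phases

variable {d : ℕ} {G : Type*} [Group G] {B : Background d G} {ℓ₀ ℓ : OnSite B}
  (T : ThermodynamicLimit B)

theorem finiteHam_interpolate (h₀ h₁ : Ham ℓ) (t : ℝ) (n : ℕ) :
    finiteHam T ((1 - t) • h₀ + t • h₁) n = (1 - t) • finiteHam T h₀ n + t • finiteHam T h₁ n := by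
  simp only [finiteHam, Finset.smul_sum, ← Finset.sum_add_distrib]
  refine Finset.sum_congr rfl fun X _ => ?_
  rw [← embedOp_smul, ← embedOp_smul, ← embedOp_add]
  rfl

theorem sameGroundState_of_groundState_eq {h₀ h₁ : GappedHam T ℓ}
    (h : groundState T ℓ h₀ = groundState T ℓ h₁) : SameGroundState T h₀.1 h₁.1 :=
  Quotient.exact h

theorem exists_interpolation (h₀ h₁ : GappedHam T ℓ)
    (h : groundState T ℓ h₀ = groundState T ℓ h₁) (t : ℝ) (ht0 : 0 ≤ t) (ht1 : t ≤ 1) :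
    ∃ k : GappedHam T ℓ, k.1 = (1 - t) • h₀.1 + t • h₁.1 ∧
      groundState T ℓ k = groundState T ℓ h₀ ∧
      ∀ Δ₀ Δ₁ : ℝ, 0 < Δ₀ → 0 < Δ₁ → GapAtLeast T h₀.1 Δ₀ → GapAtLeast T h₁.1 Δ₁ →
        GapAtLeast T k.1 ((1 - t) * Δ₀ + t * Δ₁) := by
  have hs := sameGroundState_of_groundState_eq T h
  have key : ∀ Δ₀ Δ₁ : ℝ, 0 < Δ₀ → 0 < Δ₁ → GapAtLeast T h₀.1 Δ₀ → GapAtLeast T h₁.1 Δ₁ →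
      ∀ᶠ n in atTop, HasGap (finiteHam T ((1 - t) • h₀.1 + t • h₁.1) n)
          ((1 - t) * Δ₀ + t * Δ₁) ∧ ∀ ψ, IsGroundVector (finiteHam T h₀.1 n) ψ →
        IsGroundVector (finiteHam T ((1 - t) • h₀.1 + t • h₁.1) n) ψ := by
    intro Δ₀ Δ₁ hΔ₀ hΔ₁ g₀ g₁
    filter_upwards [hs, g₀, g₁] with n hn k₀ k₁
    rw [finiteHam_interpolate]
    exact k₀.interpolate (isHermitian_finiteHam T h₀.1 n) k₁ hΔ₀ hΔ₁ hn ht0 ht1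
  obtain ⟨Δ₀, hΔ₀, g₀⟩ := h₀.2
  obtain ⟨Δ₁, hΔ₁, g₁⟩ := h₁.2
  have hk := key Δ₀ Δ₁ hΔ₀ hΔ₁ g₀ g₁
  have hΔ : 0 < (1 - t) * Δ₀ + t * Δ₁ := by
    rcases ht0.eq_or_lt with rfl | ht
    · simpa using hΔ₀
    · have := mul_nonneg (sub_nonneg.2 ht1) hΔ₀.le
      positivity
  refine ⟨⟨(1 - t) • h₀.1 + t • h₁.1, _, hΔ, hk.mono fun n hn => hn.1⟩, rfl, ?_,
    fun Δ₀ Δ₁ p₀ p₁ q₀ q₁ => (key Δ₀ Δ₁ p₀ p₁ q₀ q₁).mono fun n hn => hn.1⟩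
  refine Quotient.sound ?_
  show SameGroundState T _ _
  filter_upwards [hk, g₀] with n hn k₀ χ
  obtain ⟨ψ, hψ⟩ := k₀.exists_isGroundVector (isHermitian_finiteHam T h₀.1 n) hΔ₀
  -- Both matrices are gapped with the common ground vector `ψ`, so their ground vectors are the
  -- nonzero multiples of `ψ`.
  rw [hn.1.isGroundVector_iff hΔ (hn.2 ψ hψ), k₀.isGroundVector_iff hΔ₀ hψ]

/-- The image of a ground state is unique. -/
theorem groundState_eq_of_carries (j : Inclusion ℓ₀ ℓ) {a₀ a₁ : GappedHam T ℓ₀}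
    (ha : groundState T ℓ₀ a₀ = groundState T ℓ₀ a₁) {h₀ h₁ : GappedHam T ℓ}
    (hc₀ : CarriesGroundState T j a₀.1 h₀.1) (hc₁ : CarriesGroundState T j a₁.1 h₁.1) :
    groundState T ℓ h₀ = groundState T ℓ h₁ := by
  obtain ⟨Δ, hΔ, g⟩ := a₀.2
  obtain ⟨Δ₀, hΔ₀, g₀⟩ := h₀.2
  obtain ⟨Δ₁, hΔ₁, g₁⟩ := h₁.2
  refine Quotient.sound ?_
  show SameGroundState T _ _
  filter_upwards [sameGroundState_of_groundState_eq T ha, hc₀, hc₁, g, g₀, g₁]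
    with n hn c₀ c₁ k k₀ k₁ χ
  obtain ⟨ψ, hψ⟩ := k.exists_isGroundVector (isHermitian_finiteHam T a₀.1 n) hΔ
  rw [k₀.isGroundVector_iff hΔ₀ (c₀ ψ hψ), k₁.isGroundVector_iff hΔ₁ (c₁ ψ ((hn ψ).1 hψ))]

theorem groundState_surjective : Function.Surjective (groundState T ℓ) := Quotient.mk_surjective

theorem hasConvexFibers_groundState (ℓ : OnSite B) :
    HasConvexFibers (P := fun h : Ham ℓ => IsGapped T h) (groundState T ℓ) := by
  intro h₀ h₁ h t ht0 ht1
  obtain ⟨k, hk, hk', -⟩ := exists_interpolation T h₀ h₁ h t ht0 ht1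
  exact ⟨k, hk, hk'⟩

/-- The identity inclusion. -/
def Inclusion.refl (ℓ : OnSite B) : Inclusion ℓ ℓ where
  V := 1
  isometry := by simp
  intertwines g x := by rw [twist_one, Matrix.mul_one, Matrix.one_mul]
  range_le := le_rfl

theorem isImageState_refl (z : GroundStates T ℓ) : IsImageState T (Inclusion.refl ℓ) z z := by
  obtain ⟨h, rfl⟩ := groundState_surjective T z
  refine ⟨h, h, rfl, rfl, Eventually.of_forall fun n ψ hψ => ?_⟩
  have : (Inclusion.refl ℓ).tensor (T.volume n) = 1 := tensorOp_one
  rwa [this, Matrix.one_mulVec]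

variable [∀ ℓ : OnSite B, TopologicalSpace (Ham ℓ)]

theorem samePhaseState_refl (a : StateSystem T) : SamePhaseState T a a :=
  ⟨a.1, Inclusion.refl a.1, Inclusion.refl a.1, a.2, a.2, isImageState_refl T a.2,
    isImageState_refl T a.2, Joined.refl _⟩

variable [∀ ℓ : OnSite B, IsTopologicalAddGroup (Ham ℓ)]
  [∀ ℓ : OnSite B, ContinuousSMul ℝ (Ham ℓ)]

/-- Paths of Hamiltonians project by continuity. Conversely, modifications for the given inclusions
exist, and their ground states are the given image states by uniqueness; the path between these then
yields a path between the modifications. -/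
theorem samePhaseHam_iff (hp : ∀ ℓ : OnSite B, IsSerreFibration (groundState T ℓ))
    (a b : HamSystem T) :
    SamePhaseHam T a b ↔ SamePhaseState T a.groundState b.groundState := by
  constructor
  · rintro ⟨ℓ, j, j', h, h', hj, hj', hh⟩
    exact ⟨ℓ, j, j', groundState T ℓ h, groundState T ℓ h', ⟨a.2, h, rfl, rfl, hj.2⟩,
      ⟨b.2, h', rfl, rfl, hj'.2⟩, hh.map (hp ℓ).1⟩
  · rintro ⟨ℓ, j, j', -, -, ⟨a₀, k, ha, rfl, hk⟩, ⟨b₀, k', hb, rfl, hk'⟩, hz⟩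
    obtain ⟨h, hh⟩ := exists_isModification T j a.2
    obtain ⟨h', hh'⟩ := exists_isModification T j' b.2
    rw [groundState_eq_of_carries T j ha hk hh.2,
      groundState_eq_of_carries T j' hb hk' hh'.2] at hz
    exact ⟨ℓ, j, j', h, h', hh, hh',
      (hasConvexFibers_groundState T ℓ).joined_of_joined_map (hp ℓ) hz⟩

/-- The relation on Hamiltonians is pulled back from that on ground states, so any section of the
surjection to ground states descends to an inverse. Its choice is immaterial: Hamiltonians with
equal ground states are in the same phase, by reflexivity of `SamePhaseState`. -/
theorem exists_phase_equiv (hp : ∀ ℓ : OnSite B, IsSerreFibration (groundState T ℓ)) :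
    ∃ Φ : Quot (SamePhaseHam T) ≃ Quot (SamePhaseState T),
      ∀ a : HamSystem T, Φ (Quot.mk _ a) = Quot.mk _ a.groundState := by
  have hsurj : Function.Surjective (HamSystem.groundState (T := T)) := by
    rintro ⟨ℓ, z⟩
    obtain ⟨h, rfl⟩ := groundState_surjective T z
    exact ⟨⟨ℓ, h⟩, rfl⟩
  have hs := Function.surjInv_eq hsurj
  refine ⟨⟨Quot.map HamSystem.groundState fun a b => (samePhaseHam_iff T hp a b).1,
    Quot.map (Function.surjInv hsurj) fun z w hzw => ?_, ?_, ?_⟩, fun a => rfl⟩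
  · rw [samePhaseHam_iff T hp, hs, hs]
    exact hzw
  · rintro ⟨a⟩
    refine Quot.sound ((samePhaseHam_iff T hp _ _).2 ?_)
    rw [hs]
    exact samePhaseState_refl T _
  · rintro ⟨z⟩
    exact congrArg (Quot.mk _) (hs z)

end Phases

end

end GappedPhases

theorem mainTheorem11 {d : ℕ} {G : Type*} [Group G] (B : Background d G)
    (T : ThermodynamicLimit B)
    [∀ ℓ : OnSite B, TopologicalSpace (Ham ℓ)]
    [∀ ℓ : OnSite B, IsTopologicalAddGroup (Ham ℓ)]
    [∀ ℓ : OnSite B, ContinuousSMul ℝ (Ham ℓ)] :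
    (∀ ℓ : OnSite B,
      -- linear interpolation between Hamiltonians with the same ground state
      (∀ h₀ h₁ : GappedHam T ℓ, groundState T ℓ h₀ = groundState T ℓ h₁ →
        ∀ t : ℝ, 0 ≤ t → t ≤ 1 → ∃ h : GappedHam T ℓ,
          h.1 = (1 - t) • h₀.1 + t • h₁.1 ∧ groundState T ℓ h = groundState T ℓ h₀ ∧
          ∀ Δ₀ Δ₁ : ℝ, 0 < Δ₀ → 0 < Δ₁ → GapAtLeast T h₀.1 Δ₀ → GapAtLeast T h₁.1 Δ₁ →
            GapAtLeast T h.1 ((1 - t) * Δ₀ + t * Δ₁)) ∧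
      -- each fiber is weakly contractible, and the map is surjective
      (∀ z : GroundStates T ℓ, WeaklyContractible {h : GappedHam T ℓ // groundState T ℓ h = z}) ∧
      Function.Surjective (groundState T ℓ) ∧
      -- a Serre fibration is a weak homotopy equivalence
      (IsSerreFibration (groundState T ℓ) → IsWeakHomotopyEquiv (groundState T ℓ))) ∧
    -- topological phases of Hamiltonians and of ground states are the same
    ((∀ ℓ : OnSite B, IsSerreFibration (groundState T ℓ)) →
      (∀ a b : HamSystem T,
        SamePhaseHam T a b ↔ SamePhaseState T a.groundState b.groundState) ∧
      ∃ Φ : Quot (SamePhaseHam T) ≃ Quot (SamePhaseState T),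
        ∀ a : HamSystem T, Φ (Quot.mk _ a) = Quot.mk _ a.groundState) := by
  refine ⟨fun ℓ => ⟨exists_interpolation T,
    (hasConvexFibers_groundState T ℓ).weaklyContractible (groundState_surjective T),
    groundState_surjective T,
    (hasConvexFibers_groundState T ℓ).isWeakHomotopyEquiv (groundState_surjective T)⟩,
    fun hp => ⟨samePhaseHam_iff T hp, exists_phase_equiv T hp⟩⟩
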